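/- Let $\nu\in(0,2)$ and $\theta,\ell\in\{1,2\}$. Put $G_\nu(0)=0$ and, for $s>0$, $G_\nu(s)=s^{2\nu}$ if $\nu\notin\mathbb Z$, $G_\nu(s)=s^{2\nu}\log s$ if $\nu\in\mathbb Z$. Let $X$ be a stationary, isotropic Gaussian random field on $\mathbb R^2$ with (constant) mean and covariance function $$K(\mathbf x,\mathbf y)=\sum_{j=0}^{\lfloor\nu\rfloor}\beta_j\|\mathbf x-\mathbf y\|^{2j}+\beta_\nu^*G_\nu(\|\mathbf x-\mathbf y\|)+r(\mathbf x,\mathbf y)\qquad\forall\,\mathbf x,\mathbf y\in\mathbb R^2,$$ where $\beta_0,\dots,\beta_{\lfloor\nu\rfloor}$ and $\beta^*_\nu\ne0$ are constants and $r(\mathbf x,\mathbf y)=O(\|\mathbf x-\mathbf y\|^{2\nu+\tau})$ as $\|\mathbf x-\mathbf y\|\to0$ for some constant $\tau>0$. Write $\tilde K(\mathbf x-\mathbf y)=K(\mathbf x,\mathbf y)$ and $\tilde K^{(a_1,a_2)}=\partial^{a_1+a_2}\tilde K/\partial x_1^{a_1}\partial x_2^{a_2}$. Let $\Omega\supset[0,1]^2$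 be open in $\mathbb R^2$ and let $\tilde\varphi=(\varphi_1,\varphi_2):\Omega\to\mathbb R^2$ be a $C^2(\Omega)$ diffeomorphism onto its range: $\tilde\varphi$ is injective and $C^2$, its range is open and its inverse is $C^1$ there. Write $\varphi_j^{(1,0)}=\partial\varphi_j/\partial u$, $\varphi_j^{(0,1)}=\partial\varphi_j/\partial v$ and $\Delta=\tilde\varphi([0,1]^2)$. With $\ell^c=3-\ell$, define on $[0,1]^2$ $$\mathcal J_{\nu,\ell}=\frac{\{\varphi_{\ell^c}^{(0,1)}-\varphi_{\ell^c}^{(1,0)}\}^2}{\{\varphi_1^{(1,0)}\varphi_2^{(0,1)}-\varphi_1^{(0,1)}\varphi_2^{(1,0)}\}^2}\Bigl\{-2G_\nu(\|\tilde\varphi^{(0,1)}\|)-2G_\nu(\|\tilde\varphi^{(1,0)}\|)+G_\nu(\|\tilde\varphi^{(1,0)}+\tilde\varphi^{(0,1)}\|)+G_\nu(\|\tilde\varphi^{(0,1)}-\tilde\varphi^{(1,0)}\|)\Bigr\}.$$ Assume that 1. $\mathcal J_{\nu,\ell}$ is not identically $0$ on $[0,1]^2$; 2. there is an open set containing $\{\mathbf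 x-\mathbf y:\mathbf x,\mathbf y\in\Delta,\ \mathbf x\ne\mathbf y\}$ on which $\tilde K^{(a_1,a_2)}$ exists and is continuous whenever $a_1,a_2$ are nonnegative integers with $a_1+a_2=4$; 3. there is a constant $\tilde C$ with $|\tilde K^{(a_1,a_2)}(\mathbf x-\mathbf y)|\le\tilde C\|\mathbf x-\mathbf y\|^{2\nu-4}$ for all such $a_1,a_2$ and all $\mathbf x,\mathbf y\in\Delta$ with $\mathbf x\ne\mathbf y$. For $n\ge2$ and $1\le i_1,i_2\le n$ let $\mathbf x^{i_1,i_2}=\tilde\varphi(i_1/n,i_2/n)$ and $X_{i_1,i_2}=X(\mathbf x^{i_1,i_2})$. For $1\le i_1,i_2\le n-\theta$, let $A_{\theta;i_1,i_2}$ be the $2\times2$ matrix with rows $(\mathbf x^{i_1+\theta,i_2}-\mathbf x^{i_1,i_2})'$ and $(\mathbf x^{i_1,i_2+\theta}-\mathbf x^{i_1,i_2})'$, and let $B_{\theta;i_1,i_2}$ be the one with rows $(\mathbf x^{i_1+\theta,i_2}-\mathbf x^{i_1+\theta,i_2+\theta})'$ and $(\mathbf x^{i_1,i_2+\theta}-\mathbf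 x^{i_1+\theta,i_2+\theta})'$; these matrices are invertible for all sufficiently large $n$. Let $\bar\nabla_{\theta,\ell}X_{i_1,i_2}$ be the $\ell$th coordinate of $$B_{\theta;i_1,i_2}^{-1}\begin{pmatrix}X_{i_1+\theta,i_2}-X_{i_1+\theta,i_2+\theta}\\X_{i_1,i_2+\theta}-X_{i_1+\theta,i_2+\theta}\end{pmatrix}-A_{\theta;i_1,i_2}^{-1}\begin{pmatrix}X_{i_1+\theta,i_2}-X_{i_1,i_2}\\X_{i_1,i_2+\theta}-X_{i_1,i_2}\end{pmatrix},$$ and put $\bar V_{\theta,\ell}=\sum_{1\le i_1,i_2\le n-\theta}(\bar\nabla_{\theta,\ell}X_{i_1,i_2})^2$. Then $\hat\nu_{\theta,\ell}=\{4-\log(\bar V_{\theta,\ell})/\log n\}/2$ is a strongly consistent estimator of $\nu$: $\hat\nu_{\theta,\ell}\to\nu$ almost surely as $n\to\infty$. -/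

import Mathlib

open MeasureTheory ProbabilityTheory Filter Topology Set
open scoped Matrix

noncomputable section

/-- The plane with the Euclidean norm. Coordinates are indexed by `Fin 2`, so that the index
`0` is the first coordinate and the index `1` is the second one. -/
abbrev Plane : Type := EuclideanSpace ℝ (Fin 2)

/-! ### Partial derivatives -/

/-- `∂ f / ∂ x_j`. -/
def partialD (j : Fin 2) (f : Plane → ℝ) : Plane → ℝ :=
  fun x => lineDeriv ℝ f x (EuclideanSpace.single j 1)

/-- `f^(a₁, a₂) = ∂^(a₁ + a₂) f / ∂ x₁^a₁ ∂ x₂^a₂`. -/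
def mixedPartial (a₁ a₂ : ℕ) (f : Plane → ℝ) : Plane → ℝ :=
  (partialD 0)^[a₁] ((partialD 1)^[a₂] f)

/-- The partial derivative `f^(a₁, a₂)` exists at every point of `U`: each of the successive
differentiations that define it is legitimate there. -/
def MixedPartialExistsOn (a₁ a₂ : ℕ) (f : Plane → ℝ) (U : Set Plane) : Prop :=
  (∀ b < a₂, ∀ x ∈ U,
    LineDifferentiableAt ℝ ((partialD 1)^[b] f) x (EuclideanSpace.single 1 1)) ∧
  (∀ b < a₁, ∀ x ∈ U,
    LineDifferentiableAt ℝ ((partialD 0)^[b] ((partialD 1)^[a₂] f)) x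
      (EuclideanSpace.single 0 1))

/-! ### The covariance model -/

open Classical in
/-- The principal irregular function: `G_ν(0) = 0` and, for `s > 0`, `G_ν(s) = s^(2ν)` if `ν` is
not an integer and `G_ν(s) = s^(2ν) log s` if `ν` is an integer. -/
def irregularG (ν s : ℝ) : ℝ :=
  if s = 0 then 0
  else if ∃ m : ℤ, (m : ℝ) = ν then s ^ (2 * ν) * Real.log s
  else s ^ (2 * ν)

/-- `K(x, y) = ∑_{j ≤ ⌊ν⌋} β_j ‖x - y‖^(2j) + β* G_ν(‖x - y‖) + r(x, y)` for all `x, y`, with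
`β* ≠ 0` and `r(x, y) = O(‖x - y‖^(2ν + τ))` as `‖x - y‖ → 0`, for some `τ > 0`. -/
def HasIrregularExpansion (K : Plane → Plane → ℝ) (ν : ℝ) : Prop :=
  ∃ (β : ℕ → ℝ) (βstar τ : ℝ) (r : Plane → Plane → ℝ),
    βstar ≠ 0 ∧ 0 < τ ∧
    (∀ x y, K x y = ∑ j ∈ Finset.range (⌊ν⌋₊ + 1), β j * ‖x - y‖ ^ (2 * j)
      + βstar * irregularG ν ‖x - y‖ + r x y) ∧
    ∃ C δ : ℝ, 0 < δ ∧ ∀ x y, ‖x - y‖ < δ → |r x y| ≤ C * ‖x - y‖ ^ (2 * ν + τ)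

/-- `X` is a stationary, isotropic Gaussian random field on the plane, with (constant) mean `m`
and covariance function `K`. For a Gaussian field, stationarity and isotropy amount to a constant
mean and a covariance that depends only on the distance of the two sites. -/
structure IsStationaryIsotropicGaussianField {S : Type*} [MeasurableSpace S]
    (X : Plane → S → ℝ) (P : Measure S) (m : ℝ) (K : Plane → Plane → ℝ) : Prop where
  gaussian : IsGaussianProcess X P
  mean : ∀ x, ∫ s, X x s ∂P = m
  cov : ∀ x y, cov[X x, X y; P] = K x y
  isotropic : ∀ x y x' y', ‖x - y‖ = ‖x' - y'‖ → K x y = K x' y'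

/-- The function `K̃` with `K̃(x - y) = K(x, y)`, for a stationary `K`. -/
def stationaryCov (K : Plane → Plane → ℝ) : Plane → ℝ := fun z => K z 0

/-! ### The deformed lattice -/

/-- `[0,1]²`. -/
def unitSquare : Set Plane := {x | ∀ j, x j ∈ Icc (0 : ℝ) 1}

/-- `φ` is a `C²(Ω)` diffeomorphism onto its range `φ(Ω)`: it is injective and `C²` on `Ω`, and
its inverse is `C¹` on the (open) range. -/
structure IsC2Diffeo (φ : Plane → Plane) (Ω : Set Plane) : Prop where
  contDiffOn : ContDiffOn ℝ 2 φ Ω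
  injOn : InjOn φ Ω
  isOpen_range : IsOpen (φ '' Ω)
  inverse : ∃ ψ : Plane → Plane, ContDiffOn ℝ 1 ψ (φ '' Ω) ∧ ∀ x ∈ Ω, ψ (φ x) = x

/-- The site `x^(i₁, i₂) = φ(i₁/n, i₂/n)`. -/
def site (φ : Plane → Plane) (n i₁ i₂ : ℕ) : Plane := φ !₂[(i₁ : ℝ) / n, (i₂ : ℝ) / n]

/-- The matrix `A_{θ; i₁, i₂}`. -/
def matA (φ : Plane → Plane) (n θ i₁ i₂ : ℕ) : Matrix (Fin 2) (Fin 2) ℝ :=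
  Matrix.of ![fun j => site φ n (i₁ + θ) i₂ j - site φ n i₁ i₂ j,
    fun j => site φ n i₁ (i₂ + θ) j - site φ n i₁ i₂ j]

/-- The matrix `B_{θ; i₁, i₂}`. -/
def matB (φ : Plane → Plane) (n θ i₁ i₂ : ℕ) : Matrix (Fin 2) (Fin 2) ℝ :=
  Matrix.of ![fun j => site φ n (i₁ + θ) i₂ j - site φ n (i₁ + θ) (i₂ + θ) j,
    fun j => site φ n i₁ (i₂ + θ) j - site φ n (i₁ + θ) (i₂ + θ) j]

/-- The approximate gradient `g_θ(i₁, i₂)` at the site `(i₁, i₂)`, from the values `Y` of the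
field. -/
def gradG (φ : Plane → Plane) (Y : Plane → ℝ) (n θ i₁ i₂ : ℕ) : Fin 2 → ℝ :=
  (matA φ n θ i₁ i₂)⁻¹ *ᵥ
    ![Y (site φ n (i₁ + θ) i₂) - Y (site φ n i₁ i₂),
      Y (site φ n i₁ (i₂ + θ)) - Y (site φ n i₁ i₂)]

/-- The approximate gradient `h_θ(i₁ + θ, i₂ + θ)` at the site `(i₁ + θ, i₂ + θ)`. -/
def gradH (φ : Plane → Plane) (Y : Plane → ℝ) (n θ i₁ i₂ : ℕ) : Fin 2 → ℝ :=
  (matB φ n θ i₁ i₂)⁻¹ *ᵥ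
    ![Y (site φ n (i₁ + θ) i₂) - Y (site φ n (i₁ + θ) (i₂ + θ)),
      Y (site φ n i₁ (i₂ + θ)) - Y (site φ n (i₁ + θ) (i₂ + θ))]

/-- The second-order quadratic variation `V̄_{θ, ℓ}` based on the values
`Y(x^(i₁, i₂))`, `1 ≤ i₁, i₂ ≤ n`; the index `ℓ ∈ {1, 2}` is written as the element `ℓ - 1`
of `Fin 2`. -/
def quadVar (φ : Plane → Plane) (Y : Plane → ℝ) (n θ : ℕ) (ℓ : Fin 2) : ℝ :=
  ∑ i₁ ∈ Finset.Icc 1 (n - θ), ∑ i₂ ∈ Finset.Icc 1 (n - θ),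
    (gradH φ Y n θ i₁ i₂ ℓ - gradG φ Y n θ i₁ i₂ ℓ) ^ 2

/-- The estimator `{4 - log V̄_{θ, ℓ} / log n} / 2`. -/
def nuHat (φ : Plane → Plane) (Y : Plane → ℝ) (n θ : ℕ) (ℓ : Fin 2) : ℝ :=
  (4 - Real.log (quadVar φ Y n θ ℓ) / Real.log n) / 2

/-- The function `𝒥_{ν, ℓ}` at a point `p = (u, v)`. Here `d i j` is `∂ φ_j / ∂ x_i` at `p`, and
`ℓ.rev` is the coordinate other than `ℓ`. -/
def calJ (φ : Plane → Plane) (ν : ℝ) (ℓ : Fin 2) (p : Plane) : ℝ :=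
  let d : Fin 2 → Fin 2 → ℝ := fun i j => partialD i (fun x => φ x j) p
  (d 1 ℓ.rev - d 0 ℓ.rev) ^ 2 / (d 0 0 * d 1 1 - d 1 0 * d 0 1) ^ 2 *
    (-2 * irregularG ν (Real.sqrt (∑ j, d 1 j ^ 2))
      - 2 * irregularG ν (Real.sqrt (∑ j, d 0 j ^ 2))
      + irregularG ν (Real.sqrt (∑ j, (d 0 j + d 1 j) ^ 2))
      + irregularG ν (Real.sqrt (∑ j, (d 1 j - d 0 j) ^ 2)))

end

/-! ### Quadratic forms of Gaussian vectors -/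

section GaussianQuadratic

variable {S : Type*} [MeasurableSpace S] {P : Measure S}

/-! The quadratic variation is a sum of squares of Gaussian variables, one for each cell of the
deformed lattice. The variable of a cell is a weighted sum of the field at its four corners. Both
approximate gradients are exact on affine functions, so the weights annihilate affine functions. The
variables are therefore centred, and in their variances the constant and quadratic parts of the
covariance cancel. With h = θ/n, `HasIrregularExpansion.cell_expansion` leaves the irregular term,
of order h^(2ν-2), with coefficient β* times the energy of the rescaled cell. That energy tends to
2𝒥 (`cellEnergy_tangentCell`). Hence all variances are O(n^(2-2ν)), and they are at least a constant
times this near a point where 𝒥 does not vanish. There are about n² cells, so the expected size is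
n^(4-2ν).

Only log V̄ / log n matters, so V̄ need not be approximated by its mean. Logarithmic factors are
harmless, and two one-sided bounds suffice.

Upper bound (`ae_eventually_quadVar_le`): a union bound over the cells costs one factor log n.

Lower bound (`ae_eventually_le_quadVar`): on a block of cells near such a point, the lower tail of a
Gaussian sum of squares with mean at least m is at most exp(-m²/(16F)), where F bounds the sum of
squared covariances (`measureReal_sum_sq_le`). Here m² has order n^(8-4ν). For F, pairs of cells are
split at distance √h. There are O(n³) near pairs, each with covariance O(n^(2-2ν)). For far pairs
the covariance is a difference of second order in each of the two cells. The fourth-derivative bound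
then makes it O(h^ν) (`abs_cellCov_far_le`). Both contributions are O(n^(8-4ν-ε)) for some ε > 0
because ν < 2, so the tails are at most exp(-cn^ε) and Borel–Cantelli applies. -/

lemma exp_neg_mul_sq_gaussianReal_le (v : NNReal) {t : ℝ} (ht : 0 ≤ t) :
    ∫ x, Real.exp (-t * x ^ 2) ∂(gaussianReal 0 v) ≤ Real.exp (-t * v + t ^ 2 * v ^ 2) := by
  rcases eq_or_ne v 0 with rfl | hv
  · simp
  have hv0 : (0 : ℝ) < v := by positivity
  have hpos : 0 < 1 + 2 * t * v := by positivity
  have h1 : ∫ x, Real.exp (-t * x ^ 2) ∂(gaussianReal 0 v) = (Real.sqrt (1 + 2 * t * v))⁻¹ := by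
    rw [integral_gaussianReal_eq_integral_smul hv]
    have : ∀ x : ℝ, gaussianPDFReal 0 v x • Real.exp (-t * x ^ 2)
        = (Real.sqrt (2 * Real.pi * v))⁻¹ * Real.exp (-((1 + 2 * t * v) / (2 * v)) * x ^ 2) := by
      intro x
      rw [gaussianPDFReal, smul_eq_mul, mul_assoc, ← Real.exp_add]
      congr 2
      field_simp
      ring
    simp_rw [this]
    rw [integral_const_mul, integral_gaussian, ← Real.sqrt_inv, ← Real.sqrt_inv,
      ← Real.sqrt_mul (by positivity)]
    congr 1
    field_simp
  rw [h1, inv_le_iff_one_le_mul₀' (by positivity), ← Real.exp_log hpos, Real.sqrt_eq_rpow,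
    ← Real.exp_mul, ← Real.exp_add, Real.one_le_exp_iff]
  -- For y ≥ 0, y - y²/2 ≤ 2y/(y+2) ≤ log(1+y). Half of this, at y = 2tv, is the exponent in the
  -- claim.
  have h2 : 2 * t * v - (2 * t * v) ^ 2 / 2 ≤ Real.log (1 + 2 * t * v) := by
    have h3 := Real.le_log_one_add_of_nonneg (x := 2 * t * v) (by positivity)
    refine le_trans ?_ h3
    rw [le_div_iff₀ (by positivity)]
    have : 0 ≤ 2 * t * v := by positivity
    nlinarith [pow_nonneg this 3]
  linarith

lemma ProbabilityTheory.HasGaussianLaw.integral_exp_neg_sq_le {W : S → ℝ} (hW : HasGaussianLaw W P)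
    (h0 : ∫ s, W s ∂P = 0) {t : ℝ} (ht : 0 ≤ t) :
    ∫ s, Real.exp (-t * W s ^ 2) ∂P ≤ Real.exp (-t * Var[W; P] + t ^ 2 * Var[W; P] ^ 2) := by
  have h := exp_neg_mul_sq_gaussianReal_le Var[W; P].toNNReal ht
  rw [Real.coe_toNNReal _ (variance_nonneg _ _)] at h
  rw [← h0, ← hW.map_eq_gaussianReal, integral_map hW.aemeasurable (by fun_prop)] at h
  exact h

lemma ProbabilityTheory.HasGaussianLaw.measureReal_abs_ge_le [IsProbabilityMeasure P] {W : S → ℝ}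
    (hW : HasGaussianLaw W P) (h0 : ∫ s, W s ∂P = 0) {v x : ℝ} (hv : Var[W; P] ≤ v)
    (hx : 0 ≤ x) : P.real {s | x ≤ |W s|} ≤ 2 * Real.exp (-x ^ 2 / (2 * v)) := by
  have hv0 : 0 ≤ v := (variance_nonneg _ _).trans hv
  have hsub : HasSubgaussianMGF W v.toNNReal P := by
    have hmap := hW.map_eq_gaussianReal
    refine ⟨fun t => ?_, fun t => ?_⟩
    · have := integrable_exp_mul_gaussianReal (μ := ∫ s, W s ∂P) (v := Var[W; P].toNNReal) t
      rw [← hmap] at this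
      exact this.comp_aemeasurable hW.aemeasurable
    · rw [mgf_gaussianReal hmap, h0, Real.coe_toNNReal _ (variance_nonneg _ _),
        Real.coe_toNNReal _ hv0]
      gcongr
      nlinarith [sq_nonneg t]
  have h1 := hsub.measure_ge_le hx
  have h2 := hsub.neg.measure_ge_le hx
  rw [Real.coe_toNNReal _ hv0] at h1 h2
  calc P.real {s | x ≤ |W s|} ≤ P.real ({s | x ≤ W s} ∪ {s | x ≤ (-W) s}) := by
        refine measureReal_mono fun s hs => ?_
        simpa [le_abs] using hs
    _ ≤ _ := (measureReal_union_le _ _).trans (by linarith)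

variable {ι : Type*} [Fintype ι]

/-- Principal components of a centred Gaussian vector. -/
lemma ProbabilityTheory.HasGaussianLaw.exists_independent_components [IsProbabilityMeasure P] {Z : ι → S → ℝ}
    (hZ : HasGaussianLaw (fun s => (Z · s)) P) (h0 : ∀ i, ∫ s, Z i s ∂P = 0) :
    ∃ W : ι → S → ℝ, iIndepFun W P ∧ (∀ i, HasGaussianLaw (W i) P) ∧
      (∀ i, ∫ s, W i s ∂P = 0) ∧ (∀ s, ∑ i, W i s ^ 2 = ∑ i, Z i s ^ 2) ∧
      ∑ i, Var[W i; P] = ∑ i, Var[Z i; P] ∧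
      ∑ i, Var[W i; P] ^ 2 = ∑ i, ∑ j, cov[Z i, Z j; P] ^ 2 := by
  classical
  let C : Matrix ι ι ℝ := Matrix.of fun i j => cov[Z i, Z j; P]
  have hC : C.IsHermitian := by
    ext i j
    simp [C, covariance_comm]
  let b := hC.eigenvectorBasis
  let lam := hC.eigenvalues
  have hb : ∀ k i, ∑ j, C i j * b k j = lam k * b k i := by
    intro k i
    have := congrFun (hC.mulVec_eigenvectorBasis k) i
    simpa [Matrix.mulVec, dotProduct] using this
  have hbb : ∀ k l, ∑ i, b k i * b l i = if k = l then 1 else 0 := by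
    intro k l
    have := orthonormal_iff_ite.1 b.orthonormal k l
    rw [← this, PiLp.inner_apply]
    simp [mul_comm]
  have parseval : ∀ x : ι → ℝ, ∑ k, (∑ i, b k i * x i) ^ 2 = ∑ i, x i ^ 2 := by
    intro x
    have := b.sum_sq_norm_inner_right (WithLp.toLp 2 x)
    rw [EuclideanSpace.norm_sq_eq] at this
    simpa [PiLp.inner_apply, mul_comm] using this
  have hL2 : ∀ i, MemLp (Z i) 2 P := fun i => (hZ.eval i).memLp_two
  let W : ι → S → ℝ := fun k s => ∑ i, b k i * Z i s
  have hcov : ∀ k l, cov[W k, W l; P] = if k = l then lam l else 0 := by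
    intro k l
    have h1 : cov[W k, W l; P] = ∑ i, ∑ j, b k i * (b l j * C i j) := by
      rw [covariance_fun_sum_fun_sum (fun i => (hL2 i).const_mul _)
        (fun i => (hL2 i).const_mul _)]
      simp [covariance_const_mul_left, covariance_const_mul_right, C, mul_left_comm]
    rw [h1]
    have h2 : ∀ i, ∑ j, b k i * (b l j * C i j) = lam l * (b k i * b l i) := by
      intro i
      rw [← Finset.mul_sum, mul_left_comm, ← hb]
      simp [mul_comm]
    simp_rw [h2]
    rw [← Finset.mul_sum, hbb]
    simp
  have hjoint : HasGaussianLaw (fun s => (W · s)) P := by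
    let L : (ι → ℝ) →L[ℝ] (ι → ℝ) :=
      ContinuousLinearMap.pi fun k => ∑ i, b k i • ContinuousLinearMap.proj (R := ℝ) i
    have hLW : (fun s => L (Z · s)) = fun s => (W · s) := by
      ext s k
      simp [L, W]
    exact hLW ▸ hZ.map_fun L
  have hvar : ∀ k, Var[W k; P] = lam k := by
    intro k
    rw [← covariance_self ((hjoint.eval k).aemeasurable), hcov]
    simp
  refine ⟨W, hjoint.iIndepFun_of_covariance_eq_zero fun i j hij => by rw [hcov, if_neg hij],
    fun i => hjoint.eval i, fun k => ?_, fun s => parseval fun i => Z i s, ?_, ?_⟩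
  · simp only [W]
    rw [integral_finsetSum _ fun i _ => ((hL2 i).integrable (by norm_num)).const_mul _]
    simp [integral_const_mul, h0]
  · simp_rw [hvar]
    have := hC.trace_eq_sum_eigenvalues
    simp only [Matrix.trace, Matrix.diag, C, Matrix.of_apply, RCLike.ofReal_real_eq_id, id] at this
    rw [← this]
    exact Finset.sum_congr rfl fun i _ => covariance_self (hZ.eval i).aemeasurable
  · simp_rw [hvar]
    -- Parseval applied to each row of the covariance matrix: its Frobenius norm is the sum of the
    -- squared eigenvalues.
    have h1 : ∀ i, ∑ j, C i j ^ 2 = ∑ k, (lam k * b k i) ^ 2 := by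
      intro i
      rw [← parseval]
      simp_rw [← hb, mul_comm]
    change _ = ∑ i, ∑ j, C i j ^ 2
    simp_rw [h1]
    rw [Finset.sum_comm]
    refine Finset.sum_congr rfl fun k _ => ?_
    have := hbb k k
    simp only [if_true] at this
    simp_rw [mul_pow]
    rw [← Finset.mul_sum]
    simp_rw [sq (b k _)]
    rw [this, mul_one]

/-- Chernoff's method on the independent principal components. For a lower tail the Laplace
transform is taken at a negative argument, where it is finite for every t ≥ 0, so no bound on the
largest eigenvalue is needed. -/
lemma ProbabilityTheory.HasGaussianLaw.measureReal_sum_sq_le [IsProbabilityMeasure P] {Z : ι → S → ℝ}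
    (hZ : HasGaussianLaw (fun s => (Z · s)) P) (h0 : ∀ i, ∫ s, Z i s ∂P = 0) {m F : ℝ}
    (hm : 0 ≤ m) (hF : 0 < F) (hmV : m ≤ ∑ i, Var[Z i; P])
    (hFC : ∑ i, ∑ j, cov[Z i, Z j; P] ^ 2 ≤ F) :
    P.real {s | ∑ i, Z i s ^ 2 ≤ m / 2} ≤ Real.exp (-(m ^ 2 / (16 * F))) := by
  obtain ⟨W, hind, hG, hW0, hsq, hV, hV2⟩ := hZ.exists_independent_components h0
  -- The minimiser of the final exponent -tm/2 + t²F.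
  set t : ℝ := m / (4 * F) with ht
  have ht0 : 0 ≤ t := by positivity
  have hexp : ∫ s, Real.exp (-t * ∑ i, Z i s ^ 2) ∂P ≤ Real.exp (-t * m + t ^ 2 * F) := by
    have h1 : ∀ s, Real.exp (-t * ∑ i, Z i s ^ 2) = ∏ i, Real.exp (-t * W i s ^ 2) := by
      intro s
      rw [← hsq, Finset.mul_sum, Real.exp_sum]
    simp_rw [h1]
    have hind' : iIndepFun (fun i s => Real.exp (-t * W i s ^ 2)) P :=
      hind.comp (fun _ x => Real.exp (-t * x ^ 2)) fun _ => by fun_prop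
    have hae : ∀ i, AEMeasurable (W i) P := fun i => (hG i).aemeasurable
    rw [hind'.integral_fun_prod_eq_prod_integral fun i => by
      have := hae i
      exact (by fun_prop : AEMeasurable (fun s => Real.exp (-t * W i s ^ 2)) P).aestronglyMeasurable]
    calc ∏ i, ∫ s, Real.exp (-t * W i s ^ 2) ∂P
        ≤ ∏ i, Real.exp (-t * Var[W i; P] + t ^ 2 * Var[W i; P] ^ 2) :=
          Finset.prod_le_prod (fun i _ => integral_nonneg fun s => (Real.exp_pos _).le)
            fun i _ => (hG i).integral_exp_neg_sq_le (hW0 i) ht0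
      _ = Real.exp (-t * ∑ i, Var[Z i; P] + t ^ 2 * ∑ i, ∑ j, cov[Z i, Z j; P] ^ 2) := by
          rw [← Real.exp_sum, Finset.sum_add_distrib, ← Finset.mul_sum, ← Finset.mul_sum, hV, hV2]
      _ ≤ _ := by
          apply Real.exp_le_exp.2
          nlinarith [mul_le_mul_of_nonneg_left hmV ht0, mul_le_mul_of_nonneg_left hFC (sq_nonneg t)]
  have hint : Integrable (fun s => Real.exp (-t * ∑ i, Z i s ^ 2)) P := by
    have hae : ∀ i, AEMeasurable (Z i) P := fun i => (hZ.eval i).aemeasurable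
    refine Integrable.of_bound (C := 1) (by fun_prop) (ae_of_all _ fun s => ?_)
    rw [Real.norm_of_nonneg (Real.exp_pos _).le, Real.exp_le_one_iff]
    have : 0 ≤ ∑ i, Z i s ^ 2 := Finset.sum_nonneg fun i _ => sq_nonneg _
    nlinarith
  have hmarkov := mul_meas_ge_le_integral_of_nonneg
    (ae_of_all P fun s => (Real.exp_pos (-t * ∑ i, Z i s ^ 2)).le) hint (Real.exp (-t * (m / 2)))
  have hsubset : P.real {s | ∑ i, Z i s ^ 2 ≤ m / 2} ≤
      P.real {s | Real.exp (-t * (m / 2)) ≤ Real.exp (-t * ∑ i, Z i s ^ 2)} := by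
    refine measureReal_mono fun s hs => ?_
    simp only [mem_ofPred_eq] at hs ⊢
    apply Real.exp_le_exp.2
    nlinarith
  have h3 : P.real {s | ∑ i, Z i s ^ 2 ≤ m / 2} ≤
      Real.exp (-t * m + t ^ 2 * F) / Real.exp (-t * (m / 2)) := by
    rw [le_div_iff₀ (Real.exp_pos _), mul_comm]
    exact (mul_le_mul_of_nonneg_left hsubset (Real.exp_pos _).le).trans (hmarkov.trans hexp)
  refine h3.trans ?_
  rw [← Real.exp_sub]
  gcongr
  rw [ht]
  apply le_of_eq
  field_simp
  ring

end GaussianQuadratic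

/-! ### Iterated directional derivatives -/

section DirDeriv

variable {E : Type*} [NormedAddCommGroup E] [NormedSpace ℝ E]

/-- The iterated directional derivative along a list of vectors, the last vector first. -/
noncomputable def iterDirDeriv : List E → (E → ℝ) → E → ℝ
  | [], f => f
  | v :: l, f => fun x => fderiv ℝ (iterDirDeriv l f) x v

lemma contDiffOn_iterDirDeriv {f : E → ℝ} {V : Set E} (hV : IsOpen V) {n : ℕ} (l : List E)
    (hf : ContDiffOn ℝ (n + l.length : ℕ) f V) : ContDiffOn ℝ n (iterDirDeriv l f) V := by
  induction l generalizing n with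
  | nil => simpa [iterDirDeriv] using hf
  | cons v l ih =>
    have h : ContDiffOn ℝ (n + 1 : ℕ) (iterDirDeriv l f) V :=
      ih (by simpa [add_assoc, add_comm 1] using hf)
    exact (h.fderiv_of_isOpen (m := n) hV (by norm_cast)).clm_apply contDiffOn_const

lemma ContDiffOn.hasDerivAt_comp_line {f : E → ℝ} {V : Set E} (hV : IsOpen V)
    (hf : ContDiffOn ℝ 1 f V) {γ : ℝ → E} {v : E} {t : ℝ} (hγ : HasDerivAt γ v t) (ht : γ t ∈ V) :
    HasDerivAt (fun s => f (γ s)) (iterDirDeriv [v] f (γ t)) t :=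
  ((hf.differentiableOn one_ne_zero).differentiableAt (hV.mem_nhds ht)).hasFDerivAt.comp_hasDerivAt
    t hγ

/-- Symmetry of the second derivative exchanges the two outermost directions. Openness of `V` lets
an identity on `V` be differentiated again, which gives all other permutations. -/
lemma iterDirDeriv_perm {f : E → ℝ} {V : Set E} (hV : IsOpen V) {l l' : List E} (h : l.Perm l')
    (hf : ContDiffOn ℝ (l.length : ℕ) f V) : EqOn (iterDirDeriv l f) (iterDirDeriv l' f) V := by
  induction h with
  | nil => exact fun _ _ => rfl
  | cons v _ ih =>
    intro x hx
    have := ih (hf.of_le (by simp))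
    simp only [iterDirDeriv]
    rw [(this.eventuallyEq_of_mem (hV.mem_nhds hx)).fderiv_eq]
  | swap u v l =>
    intro x hx
    have h2 : ContDiffOn ℝ 2 (iterDirDeriv l f) V :=
      contDiffOn_iterDirDeriv (n := 2) hV l (hf.of_le (by simp [add_comm, add_left_comm]))
    have hd : DifferentiableAt ℝ (fderiv ℝ (iterDirDeriv l f)) x :=
      ((h2.fderiv_of_isOpen (m := 1) hV (by norm_num)).differentiableOn one_ne_zero).differentiableAt
        (hV.mem_nhds hx)
    have hs := (h2.contDiffAt (hV.mem_nhds hx)).isSymmSndFDerivAt (by simp)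
    have key : ∀ w, fderiv ℝ (fun y => fderiv ℝ (iterDirDeriv l f) y w) x
        = (fderiv ℝ (fderiv ℝ (iterDirDeriv l f)) x).flip w := by
      intro w
      ext z
      rw [fderiv_clm_apply hd (differentiableAt_const _)]
      simp
    simp only [iterDirDeriv, key, ContinuousLinearMap.flip_apply]
    exact hs _ _
  | trans h1 _ ih1 ih2 => exact (ih1 hf).trans (ih2 (by rwa [← h1.length_eq]))

end DirDeriv

/-! ### Directional derivatives on the plane bounded by coordinate partial derivatives -/

lemma Plane.eq_sum_single (v : Plane) :
    v = v 0 • EuclideanSpace.single 0 1 + v 1 • EuclideanSpace.single 1 1 := by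
  ext i
  fin_cases i <;> simp

lemma Plane.abs_apply_le (v : Plane) (i : Fin 2) : |v i| ≤ ‖v‖ := by
  simpa using PiLp.norm_apply_le v i

lemma Plane.abs_clm_apply_le (L : Plane →L[ℝ] ℝ) (v : Plane) :
    |L v| ≤ ‖v‖ * (|L (EuclideanSpace.single 0 1)| + |L (EuclideanSpace.single 1 1)|) := by
  conv_lhs => rw [Plane.eq_sum_single v]
  rw [map_add, map_smul, map_smul, smul_eq_mul, smul_eq_mul]
  refine (abs_add_le _ _).trans ?_
  rw [abs_mul, abs_mul, mul_add]
  gcongr <;> exact Plane.abs_apply_le _ _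

/-- By multilinearity each direction is replaced by the two basis vectors, at the cost of a factor
2‖v‖. The list `r` collects the basis vectors already substituted; symmetry moves each new one into
it. -/
lemma abs_iterDirDeriv_append_le {f : Plane → ℝ} {V : Set Plane} (hV : IsOpen V) {n : ℕ}
    (hf : ContDiffOn ℝ n f V) {x : Plane} (hx : x ∈ V) {B : ℝ}
    (hB : ∀ w : List Plane, w.length = n →
      w ⊆ [EuclideanSpace.single 0 1, EuclideanSpace.single 1 1] → |iterDirDeriv w f x| ≤ B)
    (l : List Plane) : ∀ r : List Plane, l.length + r.length = n →
      r ⊆ [EuclideanSpace.single 0 1, EuclideanSpace.single 1 1] →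
      |iterDirDeriv (l ++ r) f x| ≤ 2 ^ l.length * (l.map norm).prod * B := by
  induction l with
  | nil => intro r h1 h2; simpa using hB r (by simpa using h1) h2
  | cons v l ih =>
    intro r h1 h2
    have key : ∀ e ∈ ([EuclideanSpace.single 0 1, EuclideanSpace.single 1 1] : List Plane),
        |fderiv ℝ (iterDirDeriv (l ++ r) f) x e| ≤ 2 ^ l.length * (l.map norm).prod * B := by
      intro e he
      have hp : (e :: (l ++ r)).Perm (l ++ e :: r) := List.perm_middle.symm
      have := iterDirDeriv_perm hV hp (hf.of_le (by simp at h1 ⊢; norm_cast; omega)) hx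
      simp only [iterDirDeriv] at this
      rw [this]
      exact ih (e :: r) (by simp at h1 ⊢; omega) (List.cons_subset.2 ⟨he, h2⟩)
    refine (Plane.abs_clm_apply_le _ v).trans ?_
    have h3 := add_le_add (key _ (List.mem_cons_self ..))
      (key _ (List.mem_cons_of_mem _ (List.mem_cons_self ..)))
    refine (mul_le_mul_of_nonneg_left h3 (norm_nonneg v)).trans (le_of_eq ?_)
    simp [pow_succ]
    ring

lemma partialD_congr {f g : Plane → ℝ} {V : Set Plane} (hV : IsOpen V) (h : EqOn f g V)
    (j : Fin 2) : EqOn (partialD j f) (partialD j g) V := fun x hx => by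
  have hline : Tendsto (fun t : ℝ => x + t • (EuclideanSpace.single j 1 : Plane)) (𝓝 0) (𝓝 x) := by
    have : Continuous fun t : ℝ => x + t • (EuclideanSpace.single j 1 : Plane) := by fun_prop
    simpa using this.tendsto 0
  exact Filter.EventuallyEq.deriv_eq
    ((hline.eventually (hV.mem_nhds hx)).mono fun t ht => h ht)

lemma iterate_partialD_eqOn {f : Plane → ℝ} {V : Set Plane} (hV : IsOpen V) (j : Fin 2)
    {g : Plane → ℝ} {l : List Plane} (hg : EqOn g (iterDirDeriv l f) V) (n : ℕ)
    (hf : ContDiffOn ℝ (n + l.length : ℕ) f V) :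
    EqOn ((partialD j)^[n] g)
      (iterDirDeriv (List.replicate n (EuclideanSpace.single j 1) ++ l) f) V := by
  induction n with
  | zero => simpa using hg
  | succ n ih =>
    rw [Function.iterate_succ_apply']
    have h1 := ih (hf.of_le (by norm_cast; omega))
    refine (partialD_congr hV h1 j).trans fun x hx => ?_
    have h2 : ContDiffOn ℝ (1 : ℕ)
        (iterDirDeriv (List.replicate n (EuclideanSpace.single j 1) ++ l) f) V :=
      contDiffOn_iterDirDeriv hV _ (hf.of_le (by simp; norm_cast; omega))
    exact ((h2.differentiableOn (by simp)).differentiableAt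
      (hV.mem_nhds hx)).lineDeriv_eq_fderiv

/-- Passage from the line derivatives of the hypotheses to Fréchet derivatives. -/
lemma mixedPartial_eqOn {f : Plane → ℝ} {V : Set Plane} (hV : IsOpen V) (a b : ℕ)
    (hf : ContDiffOn ℝ (a + b : ℕ) f V) :
    EqOn (mixedPartial a b f) (iterDirDeriv (List.replicate a (EuclideanSpace.single 0 1) ++
      List.replicate b (EuclideanSpace.single 1 1)) f) V := by
  have h1 := iterate_partialD_eqOn hV 1 (f := f) (l := []) (fun _ _ => rfl) b
    (hf.of_le (by simp))
  rw [List.append_nil] at h1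
  exact iterate_partialD_eqOn hV 0 h1 a (by simpa using hf)

lemma abs_iterDirDeriv_le_of_mixedPartial {f : Plane → ℝ} {V : Set Plane} (hV : IsOpen V)
    (hf : ContDiffOn ℝ 4 f V) {x : Plane} (hx : x ∈ V) {B : ℝ}
    (hB : ∀ a b : ℕ, a + b = 4 → |mixedPartial a b f x| ≤ B) (u v : Plane) :
    |iterDirDeriv [u, u, v, v] f x| ≤ 16 * B * (‖u‖ ^ 2 * ‖v‖ ^ 2) := by
  classical
  have hne : (EuclideanSpace.single 0 1 : Plane) ≠ EuclideanSpace.single 1 1 := fun h => by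
    simpa using congrArg (fun z : Plane => z 0) h
  have := abs_iterDirDeriv_append_le hV (n := 4) hf hx (B := B) (fun w hw hsub => ?_)
    [u, u, v, v] [] (by simp) (by simp)
  · rw [List.append_nil] at this
    refine this.trans (le_of_eq ?_)
    simp
    ring
  -- Sorting a word in the two basis vectors turns it into one of the mixed partials.
  · have hp := (List.perm_replicate_append_replicate (l := w) hne).2 ⟨rfl, rfl, hsub⟩
    have hlen := hp.length_eq
    simp only [List.length_append, List.length_replicate, hw] at hlen
    rw [iterDirDeriv_perm hV hp (by rw [hw]; exact hf) hx,
      ← mixedPartial_eqOn hV _ _ (by rw [← hlen]; exact hf) hx]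
    exact hB _ _ hlen.symm

/-! ### Double second-order differences -/

/-- The mean value inequality, used twice; the sharp constant 1/2 is not needed. -/
lemma abs_taylor_one_remainder_le {g g' g'' : ℝ → ℝ} {M : ℝ}
    (h1 : ∀ t ∈ Icc (0 : ℝ) 1, HasDerivAt g (g' t) t)
    (h2 : ∀ t ∈ Icc (0 : ℝ) 1, HasDerivAt g' (g'' t) t)
    (hM : ∀ t ∈ Icc (0 : ℝ) 1, |g'' t| ≤ M) : |g 1 - g 0 - g' 0| ≤ M := by
  have hM0 : 0 ≤ M := (abs_nonneg _).trans (hM 0 (by simp))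
  have hg' : ∀ t ∈ Icc (0 : ℝ) 1, |g' t - g' 0| ≤ M := by
    intro t ht
    have := Convex.norm_image_sub_le_of_norm_hasDerivWithin_le
      (fun x hx => (h2 x hx).hasDerivWithinAt) hM (convex_Icc 0 1) (left_mem_Icc.2 zero_le_one) ht
    simp only [Real.norm_eq_abs, sub_zero, abs_of_nonneg ht.1] at this
    exact this.trans (mul_le_of_le_one_right hM0 ht.2)
  have := Convex.norm_image_sub_le_of_norm_hasDerivWithin_le (f := fun t => g t - g' 0 * t)
    (f' := fun t => g' t - g' 0) (s := Icc 0 1) (C := M) (x := 0) (y := 1)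
    (fun x hx => by simpa using ((h1 x hx).fun_sub ((hasDerivAt_id x).const_mul (g' 0))).hasDerivWithinAt)
    hg' (convex_Icc 0 1) (by simp) (by simp)
  simpa [sub_right_comm] using this

section DoubleTaylor

variable {E : Type*} [NormedAddCommGroup E] [NormedSpace ℝ E]

/-- The remainder of the product of two first-order Taylor expansions. -/
noncomputable def doubleRemainder (f : E → ℝ) (z a b : E) : ℝ :=
  f (z + a - b) - f (z - b) - fderiv ℝ f (z - b) a - (f (z + a) - f z - fderiv ℝ f z a)
    + (fderiv ℝ f (z + a) b - fderiv ℝ f z b - iterDirDeriv [b, a] f z)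

/-- On the parameter square (s, t) ↦ z + sa - tb, the double remainder is the Taylor remainder in t
of the Taylor remainder in s. The one-variable bound is applied in t; the second t-derivative is
again a Taylor remainder in s, now of the second derivative along b. -/
lemma abs_doubleRemainder_le {f : E → ℝ} {V : Set E} (hV : IsOpen V) (hf : ContDiffOn ℝ 4 f V)
    {z a b : E} {M : ℝ}
    (hmem : ∀ s ∈ Icc (0 : ℝ) 1, ∀ t ∈ Icc (0 : ℝ) 1, z + s • a - t • b ∈ V)
    (hM : ∀ s ∈ Icc (0 : ℝ) 1, ∀ t ∈ Icc (0 : ℝ) 1,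
      |iterDirDeriv [a, a, b, b] f (z + s • a - t • b)| ≤ M) :
    |doubleRemainder f z a b| ≤ M := by
  have C : ∀ l : List E, l.length ≤ 3 → ContDiffOn ℝ 1 (iterDirDeriv l f) V := fun l hl =>
    contDiffOn_iterDirDeriv (n := 1) hV l (hf.of_le (by norm_cast; omega))
  have neg : ∀ (l : List E) (x : E), iterDirDeriv (-b :: l) f x = -iterDirDeriv (b :: l) f x :=
    fun l x => map_neg _ _
  have ds : ∀ l : List E, l.length ≤ 3 → ∀ s ∈ Icc (0 : ℝ) 1, ∀ t ∈ Icc (0 : ℝ) 1,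
      HasDerivAt (fun s : ℝ => iterDirDeriv l f (z + s • a - t • b))
        (iterDirDeriv (a :: l) f (z + s • a - t • b)) s := by
    intro l hl s hs t ht
    refine (C l hl).hasDerivAt_comp_line hV (γ := fun s : ℝ => z + s • a - t • b) ?_ (hmem s hs t ht)
    simpa using (((hasDerivAt_id s).smul_const a).const_add z).sub_const (t • b)
  have dt : ∀ l : List E, l.length ≤ 3 → ∀ s ∈ Icc (0 : ℝ) 1, ∀ t ∈ Icc (0 : ℝ) 1,
      HasDerivAt (fun t : ℝ => iterDirDeriv l f (z + s • a - t • b))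
        (-iterDirDeriv (b :: l) f (z + s • a - t • b)) t := by
    intro l hl s hs t ht
    rw [← neg]
    refine (C l hl).hasDerivAt_comp_line hV (γ := fun t : ℝ => z + s • a - t • b) ?_ (hmem s hs t ht)
    simpa using (((hasDerivAt_id t).smul_const b).const_sub (z + s • a))
  have i0 : (0 : ℝ) ∈ Icc (0 : ℝ) 1 := by simp
  have i1 : (1 : ℝ) ∈ Icc (0 : ℝ) 1 := by simp
  have main := abs_taylor_one_remainder_le (M := M)
    (g := fun t : ℝ => iterDirDeriv [] f (z + (1 : ℝ) • a - t • b)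
      - iterDirDeriv [] f (z + (0 : ℝ) • a - t • b) - iterDirDeriv [a] f (z + (0 : ℝ) • a - t • b))
    (g' := fun t : ℝ => -iterDirDeriv [b] f (z + (1 : ℝ) • a - t • b)
      - -iterDirDeriv [b] f (z + (0 : ℝ) • a - t • b)
      - -iterDirDeriv [b, a] f (z + (0 : ℝ) • a - t • b))
    (g'' := fun t : ℝ => -(-iterDirDeriv [b, b] f (z + (1 : ℝ) • a - t • b))
      - -(-iterDirDeriv [b, b] f (z + (0 : ℝ) • a - t • b))
      - -(-iterDirDeriv [b, b, a] f (z + (0 : ℝ) • a - t • b)))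
    (fun t ht => ((dt [] (by simp) 1 i1 t ht).sub (dt [] (by simp) 0 i0 t ht)).sub
      (dt [a] (by simp) 0 i0 t ht))
    (fun t ht => ((dt [b] (by simp) 1 i1 t ht).neg.sub (dt [b] (by simp) 0 i0 t ht).neg).sub
      (dt [b, a] (by simp) 0 i0 t ht).neg)
    (fun t ht => by
      have hp : [b, b, a].Perm [a, b, b] :=
        (List.perm_append_comm (l₁ := [b, b]) (l₂ := [a]))
      have e := iterDirDeriv_perm hV hp (hf.of_le (by norm_num)) (hmem 0 i0 t ht)
      simp only [neg_neg]
      rw [e]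
      exact abs_taylor_one_remainder_le
        (g := fun s : ℝ => iterDirDeriv [b, b] f (z + s • a - t • b))
        (fun s hs => ds [b, b] (by simp) s hs t ht)
        (fun s hs => ds [a, b, b] (by simp) s hs t ht) (fun s hs => hM s hs t ht))
  convert main using 2
  simp only [doubleRemainder, iterDirDeriv, one_smul, zero_smul, add_zero, sub_zero]
  ring

/-- Weights that annihilate affine functions reduce a covariance sum to double remainders. -/
lemma sum_mul_mul_eq_sum_doubleRemainder {κ : Type*} [Fintype κ] (f : E → ℝ) (z : E)
    {c d : κ → ℝ} {a b : κ → E} (hc : ∑ k, c k = 0) (hca : ∑ k, c k • a k = 0)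
    (hd : ∑ k, d k = 0) (hdb : ∑ k, d k • b k = 0) :
    ∑ k, ∑ l, c k * d l * f (z + a k - b l) = ∑ k, ∑ l, c k * d l * doubleRemainder f z (a k) (b l) := by
  have hcL : ∀ L : E →L[ℝ] ℝ, ∑ k, c k * L (a k) = 0 := fun L => by
    simpa [map_sum] using congrArg L hca
  have hdL : ∀ L : E →L[ℝ] ℝ, ∑ l, d l * L (b l) = 0 := fun L => by
    simpa [map_sum] using congrArg L hdb
  have left : ∀ g : κ → ℝ, ∑ k, ∑ l, c k * d l * g k = 0 := fun g => by
    have e : ∀ k l, c k * d l * g k = c k * g k * d l := fun k l => by ring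
    simp_rw [e, ← Finset.mul_sum, hd]
    simp
  have left' : ∀ (g : κ → E →L[ℝ] ℝ), ∑ k, ∑ l, c k * d l * g k (b l) = 0 := fun g => by
    simp_rw [mul_assoc, ← Finset.mul_sum, hdL]
    simp
  have right : ∀ g : κ → ℝ, ∑ k, ∑ l, c k * d l * g l = 0 := fun g => by
    rw [Finset.sum_comm]
    simp_rw [mul_assoc, ← Finset.sum_mul, hc]
    simp
  have right' : ∀ (g : κ → E →L[ℝ] ℝ), ∑ k, ∑ l, c k * d l * g l (a k) = 0 := fun g => by
    rw [Finset.sum_comm]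
    have e : ∀ k l, c k * d l * g l (a k) = d l * (c k * g l (a k)) := fun k l => by ring
    simp_rw [e, ← Finset.mul_sum, hcL]
    simp
  rw [← sub_eq_zero, ← Finset.sum_sub_distrib]
  simp_rw [← Finset.sum_sub_distrib]
  -- Every subtracted term is constant or linear in one of the two displacements, so one of the two
  -- families of weights annihilates it.
  have e : ∀ k l, c k * d l * f (z + a k - b l) - c k * d l * doubleRemainder f z (a k) (b l)
      = c k * d l * f (z - b l) + c k * d l * fderiv ℝ f (z - b l) (a k)
        + c k * d l * (f (z + a k) - f z - fderiv ℝ f z (a k))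
        - c k * d l * (fderiv ℝ f (z + a k) - fderiv ℝ f z
            - fderiv ℝ (fun x => fderiv ℝ f x (a k)) z) (b l) := by
    intro k l
    simp only [doubleRemainder, iterDirDeriv, _root_.sub_apply]
    ring
  simp_rw [e, Finset.sum_sub_distrib, Finset.sum_add_distrib]
  rw [right fun l => f (z - b l), right' fun l => fderiv ℝ f (z - b l),
    left fun k => f (z + a k) - f z - fderiv ℝ f z (a k),
    left' fun k => fderiv ℝ f (z + a k) - fderiv ℝ f z - fderiv ℝ (fun x => fderiv ℝ f x (a k)) z]
  simp

end DoubleTaylor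

/-! ### Smoothness of an isotropic covariance away from the origin -/

lemma iterate_partialD_zero_axis (f : Plane → ℝ) (n : ℕ) (s : ℝ) :
    (partialD 0)^[n] f (s • EuclideanSpace.single 0 1)
      = deriv^[n] (fun t : ℝ => f (t • EuclideanSpace.single 0 1)) s := by
  induction n generalizing s with
  | zero => rfl
  | succ n ih =>
    rw [Function.iterate_succ_apply', Function.iterate_succ_apply', partialD, lineDeriv]
    simp_rw [← add_smul, ih]
    rw [deriv_comp_const_add, add_zero]

/-- Existence of partial derivatives alone does not give differentiability; isotropy fills the gap.
Along the first axis the pure fourth partial shows that the radial profile is C⁴, and the norm is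
smooth off the origin. -/
lemma contDiffOn_of_radial {f : Plane → ℝ} {R : ℝ} {U : Set Plane}
    (hrad : ∀ x y, ‖x‖ = ‖y‖ → f x = f y) (hU : ∀ z : Plane, z ≠ 0 → ‖z‖ < R → z ∈ U)
    (hex : MixedPartialExistsOn 4 0 f U) (hcont : ContinuousOn (mixedPartial 4 0 f) U) :
    ContDiffOn ℝ 4 f {z | z ≠ 0 ∧ ‖z‖ < R} := by
  set k : ℝ → ℝ := fun s => f (s • EuclideanSpace.single 0 1) with hk
  have hmem : ∀ s ∈ Ioo 0 R, s • (EuclideanSpace.single 0 1 : Plane) ∈ U := by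
    intro s hs
    refine hU _ (by simp [hs.1.ne']) (by simpa [norm_smul, abs_of_pos hs.1] using hs.2)
  have hdiff : ∀ b < 4, DifferentiableOn ℝ (deriv^[b] k) (Ioo 0 R) := by
    intro b hb s hs
    have h := hex.2 b hb _ (hmem s hs)
    simp only [Function.iterate_zero, id_eq, LineDifferentiableAt, ← add_smul,
      iterate_partialD_zero_axis] at h
    have h2 : DifferentiableAt ℝ (fun t => deriv^[b] k (s + t)) (s - s) := by
      rw [sub_self]
      exact h
    have h3 := differentiableAt_comp_sub_const.2 h2
    simp only [add_sub_cancel] at h3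
    exact h3.differentiableWithinAt
  -- The induction descends from the continuous fourth derivative to the profile itself.
  have hcd : ∀ j : ℕ, j ≤ 4 → ContDiffOn ℝ j (deriv^[4 - j] k) (Ioo 0 R) := by
    intro j
    induction j with
    | zero =>
      intro _
      rw [Nat.cast_zero, contDiffOn_zero]
      have hline : Continuous fun s : ℝ => s • (EuclideanSpace.single 0 1 : Plane) := by fun_prop
      refine (hcont.comp hline.continuousOn hmem).congr fun s _ => ?_
      exact (iterate_partialD_zero_axis f 4 s).symm
    | succ j ih =>
      intro hj
      rw [Nat.cast_succ, contDiffOn_succ_iff_deriv_of_isOpen isOpen_Ioo]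
      refine ⟨hdiff _ (by omega), by simp, ?_⟩
      rw [← Function.iterate_succ_apply' deriv, show (4 - (j + 1)).succ = 4 - j by omega]
      exact ih (by omega)
  have hk4 : ContDiffOn ℝ 4 k (Ioo 0 R) := hcd 4 le_rfl
  have hfk : f = k ∘ norm := by
    ext z
    exact hrad _ _ (by simp [norm_smul])
  rw [hfk]
  refine hk4.comp (fun z hz => (contDiffAt_norm ℝ hz.1).contDiffWithinAt) fun z hz => ?_
  exact ⟨norm_pos_iff.2 hz.1, hz.2⟩

/-! ### The irregular function -/

lemma irregularG_eq {ν : ℝ} (hν : ν ∈ Ioo (0 : ℝ) 2) :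
    (ν = 1 ∧ ∀ s, irregularG ν s = s ^ 2 * Real.log s) ∨ ∀ s, irregularG ν s = s ^ (2 * ν) := by
  by_cases h : ∃ m : ℤ, (m : ℝ) = ν
  · left
    have h1 : ν = 1 := by
      obtain ⟨m, rfl⟩ := h
      have h0 : (0 : ℤ) < m := by exact_mod_cast hν.1
      have h2 : m < (2 : ℤ) := by exact_mod_cast hν.2
      have : m = 1 := by omega
      simp [this]
    refine ⟨h1, fun s => ?_⟩
    subst h1
    rw [irregularG, if_pos h]
    split_ifs with hs
    · simp [hs]
    · norm_num
  · right
    intro s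
    rw [irregularG, if_neg h]
    split_ifs with hs
    · rw [hs, Real.zero_rpow (by linarith [hν.1])]
    · rfl

lemma continuous_irregularG_norm {E : Type*} [NormedAddCommGroup E] {ν : ℝ}
    (hν : ν ∈ Ioo (0 : ℝ) 2) : Continuous fun x : E => irregularG ν ‖x‖ := by
  rcases irregularG_eq hν with ⟨-, h⟩ | h <;> simp_rw [h]
  · have := (Real.continuous_mul_log.comp (continuous_norm (E := E))).mul (continuous_norm (E := E))
    refine this.congr fun x => ?_
    change ‖x‖ * Real.log ‖x‖ * ‖x‖ = _
    ring
  · exact continuous_norm.rpow_const fun x => Or.inr (by linarith [hν.1])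

/-- In the logarithmic case G is homogeneous only up to a multiple of s². That multiple depends on
h, but the cell weights annihilate the kernel ‖x - y‖², so its size is irrelevant. -/
lemma exists_irregularG_mul {ν : ℝ} (hν : ν ∈ Ioo (0 : ℝ) 2) {h : ℝ} (hh : 0 < h) :
    ∃ κ : ℝ, ∀ s, 0 ≤ s → irregularG ν (h * s) = h ^ (2 * ν) * (irregularG ν s + κ * s ^ 2) := by
  rcases irregularG_eq hν with ⟨h1, hG⟩ | hG
  · refine ⟨Real.log h, fun s hs => ?_⟩
    rw [hG, hG, h1]
    rcases hs.eq_or_lt with rfl | hs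
    · simp
    · rw [Real.log_mul hh.ne' hs.ne']
      norm_num
      ring
  · exact ⟨0, fun s hs => by rw [hG, hG, Real.mul_rpow hh.le hs]; ring⟩

/-! ### Weights of the second-order difference on a cell -/

/-- The matrix `A` of a cell with corners `q 0, q 1, q 2, q 3`. -/
def cellA (q : Fin 4 → Plane) : Matrix (Fin 2) (Fin 2) ℝ :=
  Matrix.of ![fun j => q 1 j - q 0 j, fun j => q 2 j - q 0 j]

/-- The matrix `B` of a cell with corners `q 0, q 1, q 2, q 3`. -/
def cellB (q : Fin 4 → Plane) : Matrix (Fin 2) (Fin 2) ℝ :=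
  Matrix.of ![fun j => q 1 j - q 3 j, fun j => q 2 j - q 3 j]

/-- The weights of the difference of the two approximate gradients of a cell. -/
noncomputable def cellWeight (ℓ : Fin 2) (q : Fin 4 → Plane) : Fin 4 → ℝ :=
  ![(cellA q)⁻¹ ℓ 0 + (cellA q)⁻¹ ℓ 1, (cellB q)⁻¹ ℓ 0 - (cellA q)⁻¹ ℓ 0,
    (cellB q)⁻¹ ℓ 1 - (cellA q)⁻¹ ℓ 1, -((cellB q)⁻¹ ℓ 0 + (cellB q)⁻¹ ℓ 1)]

/-- The cells whose two corner triangles are non-degenerate. -/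
def nondegCells : Set (Fin 4 → Plane) := {q | (cellA q).det ≠ 0 ∧ (cellB q).det ≠ 0}

/-- The corners of the cell of the deformed lattice at `(i₁, i₂)`. -/
noncomputable def cellSites (φ : Plane → Plane) (n θ i₁ i₂ : ℕ) : Fin 4 → Plane :=
  ![site φ n i₁ i₂, site φ n (i₁ + θ) i₂, site φ n i₁ (i₂ + θ), site φ n (i₁ + θ) (i₂ + θ)]

lemma gradH_sub_gradG (φ : Plane → Plane) (Y : Plane → ℝ) (n θ i₁ i₂ : ℕ) (ℓ : Fin 2) :
    gradH φ Y n θ i₁ i₂ ℓ - gradG φ Y n θ i₁ i₂ ℓ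
      = ∑ k, cellWeight ℓ (cellSites φ n θ i₁ i₂) k * Y (cellSites φ n θ i₁ i₂ k) := by
  have hA : matA φ n θ i₁ i₂ = cellA (cellSites φ n θ i₁ i₂) := rfl
  have hB : matB φ n θ i₁ i₂ = cellB (cellSites φ n θ i₁ i₂) := rfl
  rw [gradH, gradG, hA, hB]
  simp only [Matrix.mulVec, dotProduct, Fin.sum_univ_two, Fin.sum_univ_four, cellWeight]
  simp [cellSites]
  ring

lemma sum_cellWeight (ℓ : Fin 2) (q : Fin 4 → Plane) : ∑ k, cellWeight ℓ q k = 0 := by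
  simp only [Fin.sum_univ_four, cellWeight]
  simp
  ring

/-- Both approximate gradients recover the gradient of a linear function exactly, since A⁻¹A = B⁻¹B
= 1, so their difference vanishes on it. -/
lemma sum_cellWeight_smul (ℓ : Fin 2) {q : Fin 4 → Plane} (hq : q ∈ nondegCells) :
    ∑ k, cellWeight ℓ q k • q k = 0 := by
  ext j
  have hA := congrFun₂ (Matrix.nonsing_inv_mul (cellA q) (isUnit_iff_ne_zero.2 hq.1)) ℓ j
  have hB := congrFun₂ (Matrix.nonsing_inv_mul (cellB q) (isUnit_iff_ne_zero.2 hq.2)) ℓ j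
  rw [Matrix.mul_apply, Fin.sum_univ_two] at hA hB
  have h := hB.trans hA.symm
  simp only [cellA, cellB, Matrix.of_apply] at h
  simp only [Fin.sum_univ_four, cellWeight, cellA, cellB]
  simp at h ⊢
  linear_combination h

lemma sum_cellWeight_smul_sub (ℓ : Fin 2) {q : Fin 4 → Plane} (hq : q ∈ nondegCells) (x : Plane) :
    ∑ k, cellWeight ℓ q k • (q k - x) = 0 := by
  simp_rw [smul_sub, Finset.sum_sub_distrib]
  rw [sum_cellWeight_smul ℓ hq, ← Finset.sum_smul, sum_cellWeight]
  simp

/-- After expanding the square, each term contains one of the two vanishing sums as a factor. -/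
lemma sum_mul_mul_norm_sub_sq {κ E : Type*} [Fintype κ] [NormedAddCommGroup E]
    [InnerProductSpace ℝ E] {c : κ → ℝ} {q : κ → E} (hc : ∑ k, c k = 0)
    (hq : ∑ k, c k • q k = 0) : ∑ k, ∑ l, c k * c l * ‖q k - q l‖ ^ 2 = 0 := by
  have e : ∀ k l, c k * c l * ‖q k - q l‖ ^ 2
      = c k * ‖q k‖ ^ 2 * c l + c k * (c l * ‖q l‖ ^ 2)
        - 2 * inner ℝ (c k • q k) (c l • q l) := by
    intro k l
    rw [norm_sub_sq_real, inner_smul_left, inner_smul_right]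
    simp
    ring
  simp_rw [e, Finset.sum_sub_distrib, Finset.sum_add_distrib, ← Finset.mul_sum, ← Finset.sum_mul,
    ← inner_sum, ← sum_inner]
  rw [hc, hq]
  simp

/-! ### Scaling and continuity of the cell weights -/

lemma cellA_affine (q : Fin 4 → Plane) (x : Plane) (h : ℝ) :
    cellA (fun k => x + h • q k) = h • cellA q := by
  ext i j
  fin_cases i <;> simp [cellA] <;> ring

lemma cellB_affine (q : Fin 4 → Plane) (x : Plane) (h : ℝ) :
    cellB (fun k => x + h • q k) = h • cellB q := by
  ext i j
  fin_cases i <;> simp [cellB] <;> ring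

lemma affine_mem_nondegCells {q : Fin 4 → Plane} (hq : q ∈ nondegCells) (x : Plane) {h : ℝ}
    (hh : h ≠ 0) : (fun k => x + h • q k) ∈ nondegCells := by
  simp only [nondegCells, mem_ofPred_eq, cellA_affine, cellB_affine, Matrix.det_smul]
  exact ⟨mul_ne_zero (pow_ne_zero _ hh) hq.1, mul_ne_zero (pow_ne_zero _ hh) hq.2⟩

lemma cellWeight_affine (ℓ : Fin 2) {q : Fin 4 → Plane} (hq : q ∈ nondegCells) (x : Plane) {h : ℝ}
    (hh : h ≠ 0) (k : Fin 4) : cellWeight ℓ (fun k => x + h • q k) k = h⁻¹ * cellWeight ℓ q k := by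
  have : Invertible h := invertibleOfNonzero hh
  simp only [cellWeight, cellA_affine, cellB_affine]
  rw [Matrix.inv_smul _ _ (isUnit_iff_ne_zero.2 hq.1), Matrix.inv_smul _ _ (isUnit_iff_ne_zero.2 hq.2),
    invOf_eq_inv]
  fin_cases k <;> simp <;> ring

lemma continuous_cellA : Continuous cellA := by
  refine continuous_matrix fun i j => ?_
  fin_cases i <;> simp [cellA] <;> fun_prop

lemma continuous_cellB : Continuous cellB := by
  refine continuous_matrix fun i j => ?_
  fin_cases i <;> simp [cellB] <;> fun_prop

lemma isOpen_nondegCells : IsOpen nondegCells :=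
  (isOpen_ne_fun continuous_cellA.matrix_det continuous_const).inter
    (isOpen_ne_fun continuous_cellB.matrix_det continuous_const)

lemma continuousOn_inv_entry {T : Type*} [TopologicalSpace T] {M : T → Matrix (Fin 2) (Fin 2) ℝ}
    (hM : Continuous M) {s : Set T} (hs : ∀ x ∈ s, (M x).det ≠ 0) (i j : Fin 2) :
    ContinuousOn (fun x => (M x)⁻¹ i j) s := by
  simp_rw [Matrix.inv_def, Matrix.smul_apply, Ring.inverse_eq_inv']
  exact (hM.matrix_det.continuousOn.inv₀ hs).smul (hM.matrix_adjugate.matrix_elem i j).continuousOn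

lemma continuousOn_cellWeight (ℓ : Fin 2) (k : Fin 4) :
    ContinuousOn (fun q => cellWeight ℓ q k) nondegCells := by
  have hA := fun j => continuousOn_inv_entry continuous_cellA
    (s := nondegCells) (fun q hq => hq.1) ℓ j
  have hB := fun j => continuousOn_inv_entry continuous_cellB
    (s := nondegCells) (fun q hq => hq.2) ℓ j
  fin_cases k
  · exact (hA 0).add (hA 1)
  · exact (hB 0).sub (hA 0)
  · exact (hB 1).sub (hA 1)
  · exact ((hB 0).add (hB 1)).neg

/-- The quadratic form of the weights of a cell with kernel `G_ν(‖x - y‖)`. -/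
noncomputable def cellEnergy (ν : ℝ) (ℓ : Fin 2) (q : Fin 4 → Plane) : ℝ :=
  ∑ k, ∑ l, cellWeight ℓ q k * cellWeight ℓ q l * irregularG ν ‖q k - q l‖

lemma continuousOn_cellEnergy {ν : ℝ} (hν : ν ∈ Ioo (0 : ℝ) 2) (ℓ : Fin 2) :
    ContinuousOn (cellEnergy ν ℓ) nondegCells := by
  refine continuousOn_finsetSum _ fun k _ => continuousOn_finsetSum _ fun l _ => ?_
  refine ((continuousOn_cellWeight ℓ k).mul (continuousOn_cellWeight ℓ l)).mul ?_
  have h : Continuous fun q : Fin 4 → Plane => q k - q l := by fun_prop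
  exact ((continuous_irregularG_norm hν).comp h).continuousOn

lemma exists_abs_cellWeight_le (ℓ : Fin 2) {𝒦 : Set (Fin 4 → Plane)} (h𝒦 : IsCompact 𝒦)
    (hsub : 𝒦 ⊆ nondegCells) :
    ∃ C : ℝ, 0 < C ∧ ∀ q ∈ 𝒦, ∀ k, |cellWeight ℓ q k| ≤ C := by
  choose C hC using fun k =>
    h𝒦.exists_bound_of_continuousOn ((continuousOn_cellWeight ℓ k).mono hsub)
  refine ⟨1 + ∑ k, |C k|, by positivity, fun q hq k => (hC k q hq).trans ?_⟩
  have := Finset.single_le_sum (f := fun k => |C k|) (fun i _ => abs_nonneg _) (Finset.mem_univ k)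
  linarith [le_abs_self (C k)]

/-- Leading term of the quadratic form of a small cell with kernel `K`. -/
lemma HasIrregularExpansion.cell_expansion {K : Plane → Plane → ℝ} {ν : ℝ}
    (hν : ν ∈ Ioo (0 : ℝ) 2) (hK : HasIrregularExpansion K ν) (ℓ : Fin 2) :
    ∃ βs : ℝ, βs ≠ 0 ∧ ∀ 𝒦 : Set (Fin 4 → Plane), IsCompact 𝒦 → 𝒦 ⊆ nondegCells → ∀ ε > 0,
      ∃ h₀ > 0, ∀ h ∈ Ioo 0 h₀, ∀ q ∈ 𝒦, ∀ x : Plane,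
        |∑ k, ∑ l, cellWeight ℓ (fun k => x + h • q k) k * cellWeight ℓ (fun k => x + h • q k) l
            * K (x + h • q k) (x + h • q l) - h ^ (2 * ν - 2) * (βs * cellEnergy ν ℓ q)|
          ≤ ε * h ^ (2 * ν - 2) := by
  obtain ⟨β, βs, τ, r, hβs, hτ, hexp, C, δ, hδ, hr⟩ := hK
  refine ⟨βs, hβs, fun 𝒦 h𝒦 hsub ε hε => ?_⟩
  obtain ⟨D, hD0, hD⟩ := exists_abs_cellWeight_le ℓ h𝒦 hsub
  obtain ⟨R, hR⟩ := h𝒦.isBounded.exists_norm_le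
  set ρ : ℝ := 2 * |R| + 1 with hρ
  have hρ0 : 0 < ρ := by positivity
  have hqρ : ∀ q ∈ 𝒦, ∀ k l, ‖q k - q l‖ ≤ ρ := by
    intro q hq k l
    have h1 := (norm_le_pi_norm q k).trans (hR q hq)
    have h2 := (norm_le_pi_norm q l).trans (hR q hq)
    linarith [norm_sub_le (q k) (q l), le_abs_self R]
  -- There are 16 pairs of corners, each with weights at most `D` and distance at most `ρ` before
  -- scaling.
  set B : ℝ := 16 * (D ^ 2 * (|C| * ρ ^ (2 * ν + τ))) with hB
  have hB0 : 0 ≤ B := by positivity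
  have hlim : Tendsto (fun h : ℝ => B * h ^ τ) (𝓝[>] 0) (𝓝 0) := by
    have h1 : Tendsto (fun h : ℝ => B * h ^ τ) (𝓝 0) (𝓝 (B * 0 ^ τ)) :=
      ((Real.continuousAt_rpow_const 0 τ (Or.inr hτ.le)).tendsto).const_mul B
    rw [Real.zero_rpow hτ.ne', mul_zero] at h1
    exact h1.mono_left nhdsWithin_le_nhds
  have hev : ∀ᶠ h in 𝓝[>] (0 : ℝ), B * h ^ τ < ε := hlim.eventually_lt_const hε
  obtain ⟨h₁, hh₁, hh₁ε⟩ := mem_nhdsGT_iff_exists_Ioo_subset.1 hev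
  refine ⟨min h₁ (δ / ρ), lt_min hh₁ (by positivity), fun h hh q hq x => ?_⟩
  have hh0 : 0 < h := hh.1
  have hsmall : B * h ^ τ < ε := hh₁ε ⟨hh0, hh.2.trans_le (min_le_left _ _)⟩
  have hhδ : h * ρ < δ := (lt_div_iff₀ hρ0).1 (hh.2.trans_le (min_le_right _ _))
  have hq' := hsub hq
  set w := cellWeight ℓ q with hw
  have hdist : ∀ k l, ‖(x + h • q k) - (x + h • q l)‖ = h * ‖q k - q l‖ := by
    intro k l
    rw [add_sub_add_left_eq_sub, ← smul_sub, norm_smul, Real.norm_of_nonneg hh0.le]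
  obtain ⟨κ, hκ⟩ := exists_irregularG_mul hν hh0
  -- As ν < 2, the polynomial part has degree at most two in the distance, and the weights
  -- annihilate it.
  have hfloor : ⌊ν⌋₊ = 0 ∨ ⌊ν⌋₊ = 1 := by
    have : ⌊ν⌋₊ < 2 := (Nat.floor_lt hν.1.le).2 (by exact_mod_cast hν.2)
    omega
  obtain ⟨b₀, b₁, hb⟩ : ∃ b₀ b₁ : ℝ, ∀ s : ℝ,
      ∑ j ∈ Finset.range (⌊ν⌋₊ + 1), β j * s ^ (2 * j) = b₀ + b₁ * s ^ 2 := by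
    rcases hfloor with h0 | h0 <;> rw [h0]
    · exact ⟨β 0, 0, fun s => by simp⟩
    · exact ⟨β 0, β 1, fun s => by simp [Finset.sum_range_succ]⟩
  have hw0 : ∑ k, w k = 0 := sum_cellWeight ℓ q
  have hw2 : ∑ k, ∑ l, w k * w l * ‖q k - q l‖ ^ 2 = 0 :=
    sum_mul_mul_norm_sub_sq (sum_cellWeight ℓ q) (sum_cellWeight_smul ℓ hq')
  have hpow : h ^ (2 * ν - 2) = h⁻¹ ^ 2 * h ^ (2 * ν) := by
    rw [Real.rpow_sub hh0, Real.rpow_two]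
    field_simp
  have key : ∑ k, ∑ l, cellWeight ℓ (fun k => x + h • q k) k
        * cellWeight ℓ (fun k => x + h • q k) l * K (x + h • q k) (x + h • q l)
        - h ^ (2 * ν - 2) * (βs * cellEnergy ν ℓ q)
      = h⁻¹ ^ 2 * ∑ k, ∑ l, w k * w l * r (x + h • q k) (x + h • q l) := by
    have e : ∀ k l, cellWeight ℓ (fun k => x + h • q k) k
        * cellWeight ℓ (fun k => x + h • q k) l * K (x + h • q k) (x + h • q l)
        = h⁻¹ ^ 2 * b₀ * (w k * w l)
          + (h⁻¹ ^ 2 * b₁ * h ^ 2 + h⁻¹ ^ 2 * βs * h ^ (2 * ν) * κ) * (w k * w l * ‖q k - q l‖ ^ 2)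
          + h⁻¹ ^ 2 * h ^ (2 * ν) * βs * (w k * w l * irregularG ν ‖q k - q l‖)
          + h⁻¹ ^ 2 * (w k * w l * r (x + h • q k) (x + h • q l)) := by
      intro k l
      rw [cellWeight_affine ℓ hq' x hh0.ne', cellWeight_affine ℓ hq' x hh0.ne', hexp, hb, hdist,
        hκ _ (norm_nonneg _)]
      ring
    simp_rw [e, Finset.sum_add_distrib, ← Finset.mul_sum]
    simp only [hw0, hw2, mul_zero, Finset.sum_const_zero]
    rw [hpow, cellEnergy]
    ring
  rw [key, abs_mul, abs_of_nonneg (by positivity : (0 : ℝ) ≤ h⁻¹ ^ 2)]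
  have hterm : ∀ k l, |w k * w l * r (x + h • q k) (x + h • q l)|
      ≤ D ^ 2 * (|C| * (ρ ^ (2 * ν + τ) * h ^ (2 * ν + τ))) := by
    intro k l
    rw [abs_mul, abs_mul, sq]
    have h1 := hr (x + h • q k) (x + h • q l) (by
      rw [hdist]
      exact (mul_le_mul_of_nonneg_left (hqρ q hq k l) hh0.le).trans_lt hhδ)
    have hexp0 : 0 ≤ 2 * ν + τ := by linarith [hν.1]
    have h2 : ‖(x + h • q k) - (x + h • q l)‖ ^ (2 * ν + τ) ≤ ρ ^ (2 * ν + τ) * h ^ (2 * ν + τ) := by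
      rw [hdist, mul_comm, Real.mul_rpow (norm_nonneg _) hh0.le]
      gcongr
      exact hqρ q hq k l
    refine mul_le_mul (mul_le_mul (hD q hq k) (hD q hq l) (abs_nonneg _) hD0.le) ?_
      (abs_nonneg _) (by positivity)
    refine h1.trans ((mul_le_mul_of_nonneg_right (le_abs_self C) (by positivity)).trans ?_)
    exact mul_le_mul_of_nonneg_left h2 (abs_nonneg _)
  have hsum : |∑ k, ∑ l, w k * w l * r (x + h • q k) (x + h • q l)|
      ≤ B * h ^ τ * h ^ (2 * ν) := by
    refine (Finset.abs_sum_le_sum_abs _ _).trans ?_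
    refine (Finset.sum_le_sum fun k _ => (Finset.abs_sum_le_sum_abs _ _).trans
      (Finset.sum_le_sum fun l _ => hterm k l)).trans (le_of_eq ?_)
    rw [Real.rpow_add hh0]
    simp [hB]
    ring
  rw [hpow, mul_left_comm]
  refine mul_le_mul_of_nonneg_left (hsum.trans ?_) (by positivity)
  exact mul_le_mul_of_nonneg_right hsmall.le (by positivity)

/-! ### Small cells of the deformed lattice -/

/-- The vertices of the unit cell. -/
noncomputable def cellVertex : Fin 4 → Plane :=
  ![0, EuclideanSpace.single 0 1, EuclideanSpace.single 1 1,
    EuclideanSpace.single 0 1 + EuclideanSpace.single 1 1]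

/-- The image under `φ` of the cell of side `h` at `p`. -/
noncomputable def imageCell (φ : Plane → Plane) (p : Plane) (h : ℝ) : Fin 4 → Plane :=
  fun k => φ (p + h • cellVertex k)

/-- The image cell, moved to the origin and magnified to unit size. -/
noncomputable def rescaledCell (φ : Plane → Plane) (p : Plane) (h : ℝ) : Fin 4 → Plane :=
  fun k => h⁻¹ • (imageCell φ p h k - φ p)

/-- The image of the unit cell under the derivative of `φ` at `p`. -/
noncomputable def tangentCell (φ : Plane → Plane) (p : Plane) : Fin 4 → Plane :=
  fun k => fderiv ℝ φ p (cellVertex k)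

lemma norm_cellVertex_le (k : Fin 4) : ‖cellVertex k‖ ≤ 2 := by
  have h := norm_add_le (EuclideanSpace.single 0 1 : Plane) (EuclideanSpace.single 1 1)
  fin_cases k <;> simp [cellVertex] at h ⊢
  linarith

lemma imageCell_eq (φ : Plane → Plane) (p : Plane) {h : ℝ} (hh : h ≠ 0) :
    imageCell φ p h = fun k => φ p + h • rescaledCell φ p h k := by
  ext1 k
  rw [rescaledCell, smul_inv_smul₀ hh, add_sub_cancel]

lemma cellSites_eq_imageCell (φ : Plane → Plane) (n θ i₁ i₂ : ℕ) :
    cellSites φ n θ i₁ i₂ = imageCell φ !₂[(i₁ : ℝ) / n, (i₂ : ℝ) / n] ((θ : ℝ) / n) := by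
  ext1 k
  fin_cases k <;> simp only [cellSites, imageCell, cellVertex, site] <;> simp <;> congr 1 <;>
    ext j <;> fin_cases j <;> simp [add_div]

lemma isCompact_unitSquare : IsCompact unitSquare := by
  have hc : IsClosed unitSquare := by
    have : unitSquare = ⋂ j : Fin 2, (fun x : Plane => x j) ⁻¹' Icc (0 : ℝ) 1 := by
      ext x
      simp [unitSquare]
    rw [this]
    exact isClosed_iInter fun j => isClosed_Icc.preimage (by fun_prop)
  refine Metric.isCompact_of_isClosed_isBounded hc
    ((Metric.isBounded_closedBall (x := (0 : Plane)) (r := 2)).subset fun x hx => ?_)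
  rw [mem_closedBall_zero_iff, Plane.eq_sum_single x]
  refine (norm_add_le _ _).trans ?_
  simp only [norm_smul, Real.norm_eq_abs, PiLp.norm_single, norm_one, mul_one,
    abs_of_nonneg (hx 0).1, abs_of_nonneg (hx 1).1]
  linarith [(hx 0).2, (hx 1).2]

lemma convex_unitSquare : Convex ℝ unitSquare := by
  intro x hx y hy a b ha hb hab j
  exact convex_Icc (0 : ℝ) 1 (hx j) (hy j) ha hb hab

lemma unitSquare_mem_nhds {p : Plane} (hp : ∀ j, p j ∈ Ioo (0 : ℝ) 1) :
    unitSquare ∈ 𝓝 p := by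
  have h : ∀ j : Fin 2, ∀ᶠ x : Plane in 𝓝 p, x j ∈ Icc (0 : ℝ) 1 := fun j => by
    have hc : Continuous fun x : Plane => x j := by fun_prop
    exact hc.continuousAt.eventually (Icc_mem_nhds (hp j).1 (hp j).2)
  exact eventually_all.2 h

section Deformation

variable {φ : Plane → Plane} {Ω S : Set Plane}

/-- The mean value inequality on the convex set S ∩ ball, with the oscillation of the derivative
controlled by its uniform continuity on S. -/
lemma exists_uniform_fderiv_approx (hΩ : IsOpen Ω) (hφ : ContDiffOn ℝ 2 φ Ω) (hS : IsCompact S)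
    (hconv : Convex ℝ S) (hSΩ : S ⊆ Ω) {ε : ℝ} (hε : 0 < ε) :
    ∃ δ > 0, ∀ p ∈ S, ∀ p' ∈ S, ‖p' - p‖ < δ →
      ‖φ p' - φ p - fderiv ℝ φ p (p' - p)‖ ≤ ε * ‖p' - p‖ := by
  have hc : ContinuousOn (fderiv ℝ φ) S :=
    (hφ.continuousOn_fderiv_of_isOpen hΩ (by norm_num)).mono hSΩ
  have huc := hS.uniformContinuousOn_of_continuous hc
  obtain ⟨δ, hδ, H⟩ := Metric.uniformContinuousOn_iff.1 huc ε hε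
  refine ⟨δ, hδ, fun p hp p' hp' hpp => ?_⟩
  refine Convex.norm_image_sub_le_of_norm_hasFDerivWithin_le' (f' := fderiv ℝ φ)
    (s := S ∩ Metric.ball p δ) (fun x hx => ?_) (fun x hx => ?_)
    (hconv.inter (convex_ball p δ)) ⟨hp, Metric.mem_ball_self hδ⟩
    ⟨hp', by rwa [Metric.mem_ball, dist_eq_norm]⟩
  · exact ((hφ.differentiableOn two_ne_zero).differentiableAt
      (hΩ.mem_nhds (hSΩ hx.1))).hasFDerivAt.hasFDerivWithinAt
  · rw [← dist_eq_norm]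
    exact (H x hx.1 p hp hx.2).le

lemma exists_dist_rescaledCell_le (hΩ : IsOpen Ω) (hφ : ContDiffOn ℝ 2 φ Ω) (hS : IsCompact S)
    (hconv : Convex ℝ S) (hSΩ : S ⊆ Ω) {ε : ℝ} (hε : 0 < ε) :
    ∃ h₀ > 0, ∀ h ∈ Ioo 0 h₀, ∀ p, (∀ k, p + h • cellVertex k ∈ S) →
      dist (rescaledCell φ p h) (tangentCell φ p) ≤ ε := by
  -- The halves compensate for `cellVertex`, whose norm is bounded by 2.
  obtain ⟨δ, hδ, H⟩ := exists_uniform_fderiv_approx hΩ hφ hS hconv hSΩ (half_pos hε)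
  refine ⟨δ / 2, half_pos hδ, fun h hh p hp => (dist_pi_le_iff hε.le).2 fun k => ?_⟩
  have hp0 : p ∈ S := by simpa [cellVertex] using hp 0
  have hv := norm_cellVertex_le k
  have hn : ‖p + h • cellVertex k - p‖ = h * ‖cellVertex k‖ := by
    rw [add_sub_cancel_left, norm_smul, Real.norm_of_nonneg hh.1.le]
  have h1 := H p hp0 _ (hp k) (by rw [hn]; nlinarith [hh.1, hh.2])
  rw [hn, add_sub_cancel_left, map_smul] at h1
  have h2 : rescaledCell φ p h k - tangentCell φ p k
      = h⁻¹ • (φ (p + h • cellVertex k) - φ p - h • fderiv ℝ φ p (cellVertex k)) := by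
    rw [smul_sub, inv_smul_smul₀ hh.1.ne']
    rfl
  rw [dist_eq_norm, h2, norm_smul, norm_inv, Real.norm_of_nonneg hh.1.le,
    inv_mul_le_iff₀ hh.1]
  refine h1.trans ?_
  nlinarith [mul_le_mul_of_nonneg_left hv (mul_pos hε hh.1).le]

lemma IsC2Diffeo.eq_zero_of_fderiv_eq_zero (hφ : IsC2Diffeo φ Ω) (hΩ : IsOpen Ω) {p : Plane}
    (hp : p ∈ Ω) {v : Plane} (hv : fderiv ℝ φ p v = 0) : v = 0 := by
  obtain ⟨ψ, hψ, hψφ⟩ := hφ.inverse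
  have h1 : DifferentiableAt ℝ φ p :=
    (hφ.contDiffOn.differentiableOn two_ne_zero).differentiableAt (hΩ.mem_nhds hp)
  have h2 : DifferentiableAt ℝ ψ (φ p) := (hψ.differentiableOn one_ne_zero).differentiableAt
    (hφ.isOpen_range.mem_nhds (mem_image_of_mem φ hp))
  have h3 : HasFDerivAt (ψ ∘ φ) (ContinuousLinearMap.id ℝ Plane) p := by
    refine (hasFDerivAt_id p).congr_of_eventuallyEq ?_
    filter_upwards [hΩ.mem_nhds hp] with x hx using hψφ x hx
  have h4 := (h2.hasFDerivAt.comp p h1.hasFDerivAt).unique h3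
  have h5 := congrArg (fun L : Plane →L[ℝ] Plane => L v) h4
  simpa [hv] using h5.symm

lemma IsC2Diffeo.jacobian_ne_zero (hφ : IsC2Diffeo φ Ω) (hΩ : IsOpen Ω) {p : Plane}
    (hp : p ∈ Ω) {u v : Plane} (hu : u = fderiv ℝ φ p (EuclideanSpace.single 0 1))
    (hv : v = fderiv ℝ φ p (EuclideanSpace.single 1 1)) : u 0 * v 1 - u 1 * v 0 ≠ 0 := by
  intro hdet
  -- If the determinant vanishes, both rows of the adjugate give kernel vectors; injectivity of the
  -- derivative forces u = 0, so the first basis vector lies in the kernel as well.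
  have h1 : fderiv ℝ φ p (v 1 • EuclideanSpace.single 0 1 - u 1 • EuclideanSpace.single 1 1) = 0 := by
    rw [map_sub, map_smul, map_smul, ← hu, ← hv]
    ext j
    fin_cases j <;> simp <;> linarith
  have h2 : fderiv ℝ φ p (v 0 • EuclideanSpace.single 0 1 - u 0 • EuclideanSpace.single 1 1) = 0 := by
    rw [map_sub, map_smul, map_smul, ← hu, ← hv]
    ext j
    fin_cases j <;> simp <;> linarith
  have e1 := hφ.eq_zero_of_fderiv_eq_zero hΩ hp h1
  have e2 := hφ.eq_zero_of_fderiv_eq_zero hΩ hp h2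
  have a1 : u 1 = 0 := by simpa using congrArg (fun z : Plane => z 1) e1
  have a2 : u 0 = 0 := by simpa using congrArg (fun z : Plane => z 1) e2
  have hu0 : fderiv ℝ φ p (EuclideanSpace.single 0 1) = 0 := by
    rw [← hu]
    ext j
    fin_cases j
    · exact a2
    · exact a1
  simpa using hφ.eq_zero_of_fderiv_eq_zero hΩ hp hu0

lemma tangentCell_eq (φ : Plane → Plane) (p : Plane) :
    tangentCell φ p = ![0, fderiv ℝ φ p (EuclideanSpace.single 0 1),
      fderiv ℝ φ p (EuclideanSpace.single 1 1), fderiv ℝ φ p (EuclideanSpace.single 0 1)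
        + fderiv ℝ φ p (EuclideanSpace.single 1 1)] := by
  ext1 k
  fin_cases k <;> simp [tangentCell, cellVertex]

lemma parallelogram_mem_nondegCells {u v : Plane} (huv : u 0 * v 1 - u 1 * v 0 ≠ 0) :
    ![0, u, v, u + v] ∈ nondegCells := by
  constructor
  · rw [Matrix.det_fin_two]
    simpa [cellA] using huv
  · rw [Matrix.det_fin_two]
    simp [cellB]
    intro h
    exact huv (by linarith)

/-- On a parallelogram the triangle of B is the point reflection of the triangle of A, so the
weights reduce to a multiple of the mixed second difference. -/
lemma cellWeight_parallelogram (u v : Plane) (ℓ : Fin 2) :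
    ∃ s : ℝ, s ^ 2 = (v ℓ.rev - u ℓ.rev) ^ 2 / (u 0 * v 1 - v 0 * u 1) ^ 2 ∧
      cellWeight ℓ ![0, u, v, u + v] = ![s, -s, -s, s] := by
  have hA : cellA ![0, u, v, u + v] = !![u 0, u 1; v 0, v 1] := by
    ext i j
    fin_cases i <;> fin_cases j <;> simp [cellA]
  have hB : cellB ![0, u, v, u + v] = !![-v 0, -v 1; -u 0, -u 1] := by
    ext i j
    fin_cases i <;> fin_cases j <;> simp [cellB]
  have huv' : -v 0 * -u 1 - -v 1 * -u 0 = -(u 0 * v 1 - u 1 * v 0) := by ring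
  have huv2 : u 0 * v 1 - v 0 * u 1 = u 0 * v 1 - u 1 * v 0 := by ring
  simp only [cellWeight, hA, hB, Matrix.inv_def, Matrix.det_fin_two_of, Matrix.adjugate_fin_two_of,
    huv', huv2, Ring.inverse_eq_inv']
  generalize u 0 * v 1 - u 1 * v 0 = J
  fin_cases ℓ
  · refine ⟨J⁻¹ * (v 1 - u 1), ?_, ?_⟩
    · simp
      ring
    · ext k
      fin_cases k <;> simp [inv_neg] <;> ring
  · refine ⟨J⁻¹ * (u 0 - v 0), ?_, ?_⟩
    · simp
      ring
    · ext k
      fin_cases k <;> simp [inv_neg] <;> ring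

/-- Among ordered pairs of corners, each side vector occurs four times with a minus sign and each
diagonal twice with a plus sign. -/
lemma cellEnergy_parallelogram (u v : Plane) (ν : ℝ) (ℓ : Fin 2) : cellEnergy ν ℓ ![0, u, v, u + v]
      = 2 * ((v ℓ.rev - u ℓ.rev) ^ 2 / (u 0 * v 1 - v 0 * u 1) ^ 2 *
        (-2 * irregularG ν ‖v‖ - 2 * irregularG ν ‖u‖ + irregularG ν ‖u + v‖
          + irregularG ν ‖v - u‖)) := by
  obtain ⟨s, hs, hw⟩ := cellWeight_parallelogram u v ℓ
  have hG0 : irregularG ν 0 = 0 := by simp [irregularG]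
  rw [cellEnergy, ← hs, hw]
  have e1 : ‖-v + -u‖ = ‖u + v‖ := by rw [← neg_add, norm_neg, add_comm]
  have e2 : ‖u - v‖ = ‖v - u‖ := norm_sub_rev u v
  simp [Fin.sum_univ_four, hG0, norm_neg, e1, e2]
  ring

lemma Plane.norm_eq_sqrt_sum (v : Plane) : ‖v‖ = Real.sqrt (∑ j, v j ^ 2) := by
  rw [EuclideanSpace.norm_eq]
  simp

lemma cellEnergy_tangentCell (hφ : IsC2Diffeo φ Ω) (hΩ : IsOpen Ω) {p : Plane} (hp : p ∈ Ω)
    (ν : ℝ) (ℓ : Fin 2) : cellEnergy ν ℓ (tangentCell φ p) = 2 * calJ φ ν ℓ p := by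
  have hd : DifferentiableAt ℝ φ p :=
    (hφ.contDiffOn.differentiableOn two_ne_zero).differentiableAt (hΩ.mem_nhds hp)
  have hpd : ∀ i j, partialD i (fun x => φ x j) p = fderiv ℝ φ p (EuclideanSpace.single i 1) j := by
    intro i j
    have h : HasFDerivAt (fun x => φ x j) ((EuclideanSpace.proj j).comp (fderiv ℝ φ p)) p :=
      (EuclideanSpace.proj (𝕜 := ℝ) j).hasFDerivAt.comp p hd.hasFDerivAt
    rw [partialD, h.differentiableAt.lineDeriv_eq_fderiv, h.fderiv]
    rfl
  rw [tangentCell_eq, cellEnergy_parallelogram]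
  simp only [calJ, hpd, Plane.norm_eq_sqrt_sum, PiLp.add_apply, PiLp.sub_apply]

lemma IsC2Diffeo.tangentCell_mem (hφ : IsC2Diffeo φ Ω) (hΩ : IsOpen Ω) {p : Plane} (hp : p ∈ Ω) :
    tangentCell φ p ∈ nondegCells := by
  rw [tangentCell_eq]
  exact parallelogram_mem_nondegCells (hφ.jacobian_ne_zero hΩ hp rfl rfl)

lemma IsC2Diffeo.continuousOn_tangentCell (hφ : IsC2Diffeo φ Ω) (hΩ : IsOpen Ω) :
    ContinuousOn (tangentCell φ) Ω :=
  continuousOn_pi.2 fun k =>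
    (hφ.contDiffOn.continuousOn_fderiv_of_isOpen hΩ (by norm_num)).clm_apply continuousOn_const

/-- The tangent cells over S form a compact subset of the open set of non-degenerate cells. A small
thickening stays inside and captures all small rescaled cells, which makes every later estimate
uniform in the position of the cell. -/
lemma IsC2Diffeo.exists_compact_rescaledCell (hφ : IsC2Diffeo φ Ω) (hΩ : IsOpen Ω)
    (hS : IsCompact S) (hconv : Convex ℝ S) (hSΩ : S ⊆ Ω) :
    ∃ 𝒦 : Set (Fin 4 → Plane), IsCompact 𝒦 ∧ 𝒦 ⊆ nondegCells ∧
      ∃ h₀ > 0, ∀ h ∈ Ioo 0 h₀, ∀ p, (∀ k, p + h • cellVertex k ∈ S) → rescaledCell φ p h ∈ 𝒦 := by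
  have hT : IsCompact (tangentCell φ '' S) :=
    hS.image_of_continuousOn ((hφ.continuousOn_tangentCell hΩ).mono hSΩ)
  obtain ⟨δ, hδ, hsub⟩ := hT.exists_cthickening_subset_open isOpen_nondegCells
    (image_subset_iff.2 fun p hp => hφ.tangentCell_mem hΩ (hSΩ hp))
  obtain ⟨h₀, hh₀, H⟩ := exists_dist_rescaledCell_le hΩ hφ.contDiffOn hS hconv hSΩ hδ
  refine ⟨_, hT.cthickening, hsub, h₀, hh₀, fun h hh p hp => ?_⟩
  have hp0 : p ∈ S := by simpa [cellVertex] using hp 0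
  exact Metric.mem_cthickening_of_dist_le _ _ _ _ (mem_image_of_mem _ hp0) (H h hh p hp)

lemma IsC2Diffeo.exists_le_abs_cellEnergy (hφ : IsC2Diffeo φ Ω) (hΩ : IsOpen Ω)
    (hS : IsCompact S) (hconv : Convex ℝ S) (hSΩ : S ⊆ Ω) {ν : ℝ} (hν : ν ∈ Ioo (0 : ℝ) 2)
    {ℓ : Fin 2} {p₀ : Plane} (hp₀ : p₀ ∈ Ω) (hJ : calJ φ ν ℓ p₀ ≠ 0) :
    ∃ c > 0, ∃ ρ > 0, ∃ h₀ > 0, ∀ h ∈ Ioo 0 h₀, ∀ p ∈ Metric.ball p₀ ρ,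
      (∀ k, p + h • cellVertex k ∈ S) → c ≤ |cellEnergy ν ℓ (rescaledCell φ p h)| := by
  have hE : 0 < |cellEnergy ν ℓ (tangentCell φ p₀)| := by
    rw [cellEnergy_tangentCell hφ hΩ hp₀]
    exact abs_pos.2 (mul_ne_zero two_ne_zero hJ)
  set c := |cellEnergy ν ℓ (tangentCell φ p₀)| / 2 with hc
  have hcont : ContinuousAt (fun q => |cellEnergy ν ℓ q|) (tangentCell φ p₀) :=
    ((continuousOn_cellEnergy hν ℓ).continuousAt
      (isOpen_nondegCells.mem_nhds (hφ.tangentCell_mem hΩ hp₀))).abs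
  obtain ⟨δ, hδ, hball⟩ := Metric.mem_nhds_iff.1
    (hcont.eventually (lt_mem_nhds (show c < _ by rw [hc]; linarith)))
  obtain ⟨h₀, hh₀, H⟩ := exists_dist_rescaledCell_le hΩ hφ.contDiffOn hS hconv hSΩ (half_pos hδ)
  have htan := ((hφ.continuousOn_tangentCell hΩ).continuousAt (hΩ.mem_nhds hp₀)).eventually
    (Metric.ball_mem_nhds _ (half_pos hδ))
  obtain ⟨ρ, hρ, hρball⟩ := Metric.mem_nhds_iff.1 htan
  refine ⟨c, by positivity, ρ, hρ, h₀, hh₀, fun h hh p hp hcorner => ?_⟩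
  have h1 := H h hh p hcorner
  have h2 : dist (tangentCell φ p) (tangentCell φ p₀) < δ / 2 := hρball hp
  have h3 : rescaledCell φ p h ∈ Metric.ball (tangentCell φ p₀) δ :=
    Metric.mem_ball.2 (by linarith [dist_triangle (rescaledCell φ p h) (tangentCell φ p) (tangentCell φ p₀)])
  exact le_of_lt (hball h3)

/-- A point of the closed square at which `𝒥` does not vanish can be moved to the interior. -/
lemma exists_interior_calJ_ne_zero (hφ : IsC2Diffeo φ Ω) (hΩ : IsOpen Ω) (hsq : unitSquare ⊆ Ω)
    {ν : ℝ} (hν : ν ∈ Ioo (0 : ℝ) 2) {ℓ : Fin 2} {p : Plane} (hp : p ∈ unitSquare)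
    (hJ : calJ φ ν ℓ p ≠ 0) : ∃ p₀ : Plane, (∀ j, p₀ j ∈ Ioo (0 : ℝ) 1) ∧ calJ φ ν ℓ p₀ ≠ 0 := by
  have hcont : ContinuousAt (fun x => cellEnergy ν ℓ (tangentCell φ x)) p :=
    ContinuousAt.comp (g := cellEnergy ν ℓ) ((continuousOn_cellEnergy hν ℓ).continuousAt
      (isOpen_nondegCells.mem_nhds (hφ.tangentCell_mem hΩ (hsq hp))))
      ((hφ.continuousOn_tangentCell hΩ).continuousAt (hΩ.mem_nhds (hsq hp)))
  have hne : ∀ᶠ x in 𝓝 p, cellEnergy ν ℓ (tangentCell φ x) ≠ 0 := by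
    refine hcont.eventually_ne ?_
    rw [cellEnergy_tangentCell hφ hΩ (hsq hp)]
    exact mul_ne_zero two_ne_zero hJ
  -- The point is moved slightly towards the centre of the square.
  have hline : Tendsto (fun t : ℝ => (1 - t) • p + t • (!₂[1 / 2, 1 / 2] : Plane)) (𝓝[>] 0) (𝓝 p) := by
    have hc : Continuous fun t : ℝ => (1 - t) • p + t • (!₂[1 / 2, 1 / 2] : Plane) := by fun_prop
    have := hc.tendsto 0
    simp only [sub_zero, one_smul, zero_smul, add_zero] at this
    exact this.mono_left nhdsWithin_le_nhds
  have hIoo : ∀ᶠ t : ℝ in 𝓝[>] 0, t ∈ Ioo (0 : ℝ) 1 := Ioo_mem_nhdsGT one_pos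
  obtain ⟨t, ht, hxΩ, htI⟩ :=
    ((hline.eventually hne).and ((hline.eventually (hΩ.mem_nhds (hsq hp))).and hIoo)).exists
  refine ⟨(1 - t) • p + t • !₂[1 / 2, 1 / 2], fun j => ?_, fun h => ht ?_⟩
  · have h1 := hp j
    fin_cases j <;> simp at h1 ⊢ <;> constructor <;> nlinarith [htI.1, htI.2, h1.1, h1.2]
  · rw [cellEnergy_tangentCell hφ hΩ hxΩ, h, mul_zero]

end Deformation

/-! ### Covariances of the second-order differences -/

/-- The covariance of the second-order differences on two cells, for the covariance `K`. -/
noncomputable def cellCov (K : Plane → Plane → ℝ) (ℓ : Fin 2) (q q' : Fin 4 → Plane) : ℝ :=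
  ∑ k, ∑ l, cellWeight ℓ q k * cellWeight ℓ q' l * K (q k) (q' l)

section CellCov

variable {φ : Plane → Plane} {Ω : Set Plane} {K : Plane → Plane → ℝ} {ν : ℝ} {ℓ : Fin 2}

lemma IsC2Diffeo.abs_cellCov_self_le (hφ : IsC2Diffeo φ Ω) (hΩ : IsOpen Ω) (hsq : unitSquare ⊆ Ω)
    (hν : ν ∈ Ioo (0 : ℝ) 2) (hK : HasIrregularExpansion K ν) :
    ∃ C > 0, ∃ h₀ > 0, ∀ h ∈ Ioo 0 h₀, ∀ p, (∀ k, p + h • cellVertex k ∈ unitSquare) →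
      |cellCov K ℓ (imageCell φ p h) (imageCell φ p h)| ≤ C * h ^ (2 * ν - 2) := by
  obtain ⟨𝒦, h𝒦, hsub, h₁, hh₁, H₁⟩ :=
    hφ.exists_compact_rescaledCell hΩ isCompact_unitSquare convex_unitSquare hsq
  obtain ⟨βs, -, H⟩ := hK.cell_expansion hν ℓ
  obtain ⟨h₂, hh₂, H₂⟩ := H 𝒦 h𝒦 hsub 1 one_pos
  obtain ⟨E, hE⟩ := h𝒦.exists_bound_of_continuousOn ((continuousOn_cellEnergy hν ℓ).mono hsub)
  refine ⟨1 + |βs| * |E|, by positivity, min h₁ h₂, lt_min hh₁ hh₂, fun h hh p hp => ?_⟩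
  have hq := H₁ h ⟨hh.1, hh.2.trans_le (min_le_left _ _)⟩ p hp
  have h2 := H₂ h ⟨hh.1, hh.2.trans_le (min_le_right _ _)⟩ _ hq (φ p)
  rw [imageCell_eq φ p hh.1.ne']
  have hpos : 0 < h ^ (2 * ν - 2) := Real.rpow_pos_of_pos hh.1 _
  have h3 : |h ^ (2 * ν - 2) * (βs * cellEnergy ν ℓ (rescaledCell φ p h))|
      ≤ h ^ (2 * ν - 2) * (|βs| * |E|) := by
    rw [abs_mul, abs_of_pos hpos, abs_mul]
    have hEq : |cellEnergy ν ℓ (rescaledCell φ p h)| ≤ |E| := (hE _ hq).trans (le_abs_self E)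
    exact mul_le_mul_of_nonneg_left (mul_le_mul_of_nonneg_left hEq (abs_nonneg _)) hpos.le
  have h4 := abs_add_le (cellCov K ℓ (fun k => φ p + h • rescaledCell φ p h k)
    (fun k => φ p + h • rescaledCell φ p h k)
    - h ^ (2 * ν - 2) * (βs * cellEnergy ν ℓ (rescaledCell φ p h)))
    (h ^ (2 * ν - 2) * (βs * cellEnergy ν ℓ (rescaledCell φ p h)))
  rw [sub_add_cancel] at h4
  calc _ ≤ _ := h4
    _ ≤ 1 * h ^ (2 * ν - 2) + h ^ (2 * ν - 2) * (|βs| * |E|) := add_le_add h2 h3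
    _ = _ := by ring

lemma IsC2Diffeo.le_abs_cellCov_self (hφ : IsC2Diffeo φ Ω) (hΩ : IsOpen Ω) (hsq : unitSquare ⊆ Ω)
    (hν : ν ∈ Ioo (0 : ℝ) 2) (hK : HasIrregularExpansion K ν) {p₀ : Plane} (hp₀ : p₀ ∈ Ω)
    (hJ : calJ φ ν ℓ p₀ ≠ 0) :
    ∃ c > 0, ∃ ρ > 0, ∃ h₀ > 0, ∀ h ∈ Ioo 0 h₀, ∀ p ∈ Metric.ball p₀ ρ,
      (∀ k, p + h • cellVertex k ∈ unitSquare) →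
      c * h ^ (2 * ν - 2) ≤ |cellCov K ℓ (imageCell φ p h) (imageCell φ p h)| := by
  obtain ⟨𝒦, h𝒦, hsub, h₁, hh₁, H₁⟩ :=
    hφ.exists_compact_rescaledCell hΩ isCompact_unitSquare convex_unitSquare hsq
  obtain ⟨βs, hβ, H⟩ := hK.cell_expansion hν ℓ
  obtain ⟨c, hc, ρ, hρ, h₃, hh₃, H₃⟩ :=
    hφ.exists_le_abs_cellEnergy hΩ isCompact_unitSquare convex_unitSquare hsq hν hp₀ hJ
  have hβ0 : 0 < |βs| := abs_pos.2 hβ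
  -- The error is kept below half of the leading term.
  obtain ⟨h₂, hh₂, H₂⟩ := H 𝒦 h𝒦 hsub (|βs| * c / 2) (by positivity)
  refine ⟨|βs| * c / 2, by positivity, ρ, hρ, min h₃ (min h₁ h₂), by positivity,
    fun h hh p hpρ hp => ?_⟩
  have hmin := hh.2
  simp only [lt_min_iff] at hmin
  have hq := H₁ h ⟨hh.1, hmin.2.1⟩ p hp
  have h2 := H₂ h ⟨hh.1, hmin.2.2⟩ _ hq (φ p)
  have h3 := H₃ h ⟨hh.1, hmin.1⟩ p hpρ hp
  rw [imageCell_eq φ p hh.1.ne']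
  have hpos : 0 < h ^ (2 * ν - 2) := Real.rpow_pos_of_pos hh.1 _
  have h4 : h ^ (2 * ν - 2) * (|βs| * c)
      ≤ |h ^ (2 * ν - 2) * (βs * cellEnergy ν ℓ (rescaledCell φ p h))| := by
    rw [abs_mul, abs_of_pos hpos, abs_mul]
    gcongr
  have h5 := abs_sub_abs_le_abs_sub (h ^ (2 * ν - 2) * (βs * cellEnergy ν ℓ (rescaledCell φ p h)))
    (cellCov K ℓ (fun k => φ p + h • rescaledCell φ p h k)
      (fun k => φ p + h • rescaledCell φ p h k))
  rw [abs_sub_comm] at h5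
  have h6 := h5.trans h2
  linarith

/-! ### Decay of covariances between distant cells -/

lemma IsC2Diffeo.image_mem_nhds (hφ : IsC2Diffeo φ Ω) {p : Plane} {N : Set Plane}
    (hN : N ∈ 𝓝 p) (hp : p ∈ Ω) : φ '' N ∈ 𝓝 (φ p) := by
  obtain ⟨ψ, hψ, hψφ⟩ := hφ.inverse
  have hx : φ '' Ω ∈ 𝓝 (φ p) := hφ.isOpen_range.mem_nhds (mem_image_of_mem φ hp)
  have hc : ContinuousAt ψ (φ p) := hψ.continuousOn.continuousAt hx
  have hN' : ψ ⁻¹' N ∈ 𝓝 (φ p) := hc (by rwa [hψφ p hp])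
  filter_upwards [hx, hN'] with y ⟨x, hxΩ, hxy⟩ hy
  refine ⟨x, ?_, hxy⟩
  rw [mem_preimage, ← hxy, hψφ x hxΩ] at hy
  exact hy

lemma IsC2Diffeo.exists_antilipschitz (hφ : IsC2Diffeo φ Ω) (hΩ : IsOpen Ω) {p : Plane}
    (hp : p ∈ Ω) : ∃ L > 0, ∀ᶠ ρ in 𝓝[>] (0 : ℝ), ∀ x ∈ Metric.ball p ρ, ∀ y ∈ Metric.ball p ρ,
      ‖x - y‖ ≤ L * ‖φ x - φ y‖ := by
  obtain ⟨ψ, hψ, hψφ⟩ := hφ.inverse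
  have hx : φ '' Ω ∈ 𝓝 (φ p) := hφ.isOpen_range.mem_nhds (mem_image_of_mem φ hp)
  obtain ⟨L, t, ht, hL⟩ := (hψ.contDiffAt hx).exists_lipschitzOnWith
  have hφc : ContinuousAt φ p := hφ.contDiffOn.continuousOn.continuousAt (hΩ.mem_nhds hp)
  obtain ⟨ρ, hρ, hball⟩ := Metric.mem_nhds_iff.1 (inter_mem (hφc ht) (hΩ.mem_nhds hp))
  -- The Lipschitz constant of the inverse may be zero; adding 1 makes it positive.
  refine ⟨L + 1, by positivity, ?_⟩
  filter_upwards [Ioo_mem_nhdsGT hρ] with ρ' hρ' x hx y hy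
  have hx' := hball (Metric.ball_subset_ball hρ'.2.le hx)
  have hy' := hball (Metric.ball_subset_ball hρ'.2.le hy)
  have := hL.dist_le_mul _ hx'.1 _ hy'.1
  rw [hψφ x hx'.2, hψφ y hy'.2, dist_eq_norm, dist_eq_norm] at this
  nlinarith [norm_nonneg (φ x - φ y)]

/-- A covariance function with fourth-order bounds gives small covariances for distant cells. -/
lemma abs_cellCov_le_of_fourth_deriv {f : Plane → ℝ} {V : Set Plane} (hV : IsOpen V)
    (hf : ContDiffOn ℝ 4 f V) {q q' : Fin 4 → Plane} {x y : Plane} {B D δ : ℝ}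
    (hq : q ∈ nondegCells) (hq' : q' ∈ nondegCells) (hKf : ∀ x y, K x y = f (x - y))
    (hmem : ∀ k l, ∀ s ∈ Icc (0 : ℝ) 1, ∀ t ∈ Icc (0 : ℝ) 1,
      x - y + s • (q k - x) - t • (q' l - y) ∈ V)
    (hB : ∀ k l, ∀ s ∈ Icc (0 : ℝ) 1, ∀ t ∈ Icc (0 : ℝ) 1, ∀ a b : ℕ, a + b = 4 →
      |mixedPartial a b f (x - y + s • (q k - x) - t • (q' l - y))| ≤ B)
    (hw : ∀ k, |cellWeight ℓ q k| ≤ D) (hw' : ∀ k, |cellWeight ℓ q' k| ≤ D)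
    (hδ : ∀ k, ‖q k - x‖ ≤ δ) (hδ' : ∀ k, ‖q' k - y‖ ≤ δ) :
    |cellCov K ℓ q q'| ≤ 256 * D ^ 2 * B * δ ^ 4 := by
  have hB0 : 0 ≤ B := (abs_nonneg _).trans
    (hB 0 0 0 (by simp) 0 (by simp) 4 0 rfl)
  have hD0 : 0 ≤ D := (abs_nonneg _).trans (hw 0)
  have hδ0 : 0 ≤ δ := (norm_nonneg _).trans (hδ 0)
  have h1 : cellCov K ℓ q q' = ∑ k, ∑ l, cellWeight ℓ q k * cellWeight ℓ q' l *
      doubleRemainder f (x - y) (q k - x) (q' l - y) := by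
    rw [← sum_mul_mul_eq_sum_doubleRemainder f (x - y) (sum_cellWeight ℓ q)
      (sum_cellWeight_smul_sub ℓ hq x) (sum_cellWeight ℓ q') (sum_cellWeight_smul_sub ℓ hq' y)]
    refine Finset.sum_congr rfl fun k _ => Finset.sum_congr rfl fun l _ => ?_
    rw [hKf]
    congr 2
    abel
  -- The final factor 256 is 16 corner pairs times the 16 from the derivative bound.
  have hterm : ∀ k l, |cellWeight ℓ q k * cellWeight ℓ q' l *
      doubleRemainder f (x - y) (q k - x) (q' l - y)| ≤ D * D * (16 * B * (δ ^ 2 * δ ^ 2)) := by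
    intro k l
    rw [abs_mul, abs_mul]
    refine mul_le_mul (mul_le_mul (hw k) (hw' l) (abs_nonneg _) hD0) ?_ (abs_nonneg _)
      (by positivity)
    refine abs_doubleRemainder_le hV hf (hmem k l) fun s hs t ht => ?_
    refine (abs_iterDirDeriv_le_of_mixedPartial hV hf (hmem k l s hs t ht)
      (hB k l s hs t ht) _ _).trans ?_
    gcongr
    exacts [hδ k, hδ' l]
  rw [h1]
  refine (Finset.abs_sum_le_sum_abs _ _).trans ((Finset.sum_le_sum fun k _ =>
    (Finset.abs_sum_le_sum_abs _ _).trans (Finset.sum_le_sum fun l _ => hterm k l)).trans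
      (le_of_eq ?_))
  simp
  ring

/-- Orders of magnitude: the weights contribute h⁻², the four displacements h⁴, and the fourth
derivatives at distance at least of order √h contribute (√h)^(2ν-4) = h^(ν-2). The product is h^ν.
The threshold √h exceeds the cell diameter O(h), so the Taylor segments stay away from the
singularity at the origin. -/
lemma IsC2Diffeo.abs_cellCov_far_le (hφ : IsC2Diffeo φ Ω) (hΩ : IsOpen Ω) (hsq : unitSquare ⊆ Ω)
    (hν : ν ∈ Ioo (0 : ℝ) 2)
    (hiso : ∀ x y x' y', ‖x - y‖ = ‖x' - y'‖ → K x y = K x' y')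
    (hK_cont : ∃ U : Set Plane, IsOpen U ∧
      (∀ x ∈ φ '' unitSquare, ∀ y ∈ φ '' unitSquare, x ≠ y → x - y ∈ U) ∧
      ∀ a₁ a₂ : ℕ, a₁ + a₂ = 4 →
        MixedPartialExistsOn a₁ a₂ (stationaryCov K) U ∧
        ContinuousOn (mixedPartial a₁ a₂ (stationaryCov K)) U)
    (hK_bound : ∃ C : ℝ, ∀ a₁ a₂ : ℕ, a₁ + a₂ = 4 →
      ∀ x ∈ φ '' unitSquare, ∀ y ∈ φ '' unitSquare, x ≠ y →
        |mixedPartial a₁ a₂ (stationaryCov K) (x - y)| ≤ C * ‖x - y‖ ^ (2 * ν - 4))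
    {p₀ : Plane} (hp₀ : ∀ j, p₀ j ∈ Ioo (0 : ℝ) 1) :
    ∃ C > 0, ∃ ρ > 0, ∃ h₀ > 0, ∀ h ∈ Ioo 0 h₀, ∀ p ∈ Metric.ball p₀ ρ, ∀ p' ∈ Metric.ball p₀ ρ,
      Real.sqrt h ≤ ‖p - p'‖ →
      |cellCov K ℓ (imageCell φ p h) (imageCell φ p' h)| ≤ C * h ^ ν := by
  obtain ⟨𝒦, h𝒦, hsub, h₁, hh₁, H₁⟩ :=
    hφ.exists_compact_rescaledCell hΩ isCompact_unitSquare convex_unitSquare hsq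
  obtain ⟨D, hD0, hD⟩ := exists_abs_cellWeight_le ℓ h𝒦 hsub
  obtain ⟨R₀, hR₀⟩ := h𝒦.isBounded.exists_norm_le
  obtain ⟨U, -, hUmem, hU⟩ := hK_cont
  obtain ⟨Cb, hCb⟩ := hK_bound
  set R : ℝ := |R₀| + 1 with hR
  have hR0 : 0 < R := by positivity
  have hsqn : unitSquare ∈ 𝓝 p₀ := unitSquare_mem_nhds hp₀
  have hp₀Ω : p₀ ∈ Ω := hsq (mem_of_mem_nhds hsqn)
  obtain ⟨r, hr, hrball⟩ := Metric.mem_nhds_iff.1 (hφ.image_mem_nhds hsqn hp₀Ω)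
  obtain ⟨L, hL, hLip⟩ := hφ.exists_antilipschitz hΩ hp₀Ω
  have hφc : ContinuousAt φ p₀ := hφ.contDiffOn.continuousOn.continuousAt (hΩ.mem_nhds hp₀Ω)
  obtain ⟨ρ₁, hρ₁, hρ₁ball⟩ := Metric.mem_nhds_iff.1
    (inter_mem (hφc (Metric.ball_mem_nhds _ hr)) hsqn)
  obtain ⟨ρ, hLρ, hρ0, hρρ₁⟩ := (hLip.and (Ioo_mem_nhdsGT (half_pos hρ₁))).exists
  set f := stationaryCov K with hf_def
  have hKf : ∀ x y, K x y = f (x - y) := fun x y => hiso _ _ _ _ (by simp)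
  set V : Set Plane := {z | z ≠ 0 ∧ ‖z‖ < 2 * r} with hV_def
  have hV : IsOpen V := isOpen_ne.inter (isOpen_lt continuous_norm continuous_const)
  -- A short vector is the difference of two points placed symmetrically about φ(p₀), which is
  -- interior to the image. The hypotheses on differences of image points thus hold on a full
  -- punctured disc.
  have hVdiff : ∀ z ∈ V, ∃ x ∈ φ '' unitSquare, ∃ y ∈ φ '' unitSquare, x ≠ y ∧ z = x - y := by
    intro z hz
    have e : φ p₀ + (1 / 2 : ℝ) • z - (φ p₀ - (1 / 2 : ℝ) • z) = z := by module
    have hn : ‖(1 / 2 : ℝ) • z‖ < r := by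
      rw [norm_smul, Real.norm_of_nonneg (by norm_num)]
      linarith [hz.2]
    refine ⟨φ p₀ + (1 / 2 : ℝ) • z, hrball ?_, φ p₀ - (1 / 2 : ℝ) • z, hrball ?_, fun h => ?_,
      e.symm⟩
    · simpa [dist_eq_norm] using hn
    · simpa [dist_eq_norm] using hn
    · rw [sub_eq_zero.2 h] at e
      exact hz.1 e.symm
  have hf4 : ContDiffOn ℝ 4 f V := by
    refine contDiffOn_of_radial (U := U) (fun x y hxy => hiso _ _ _ _ (by simpa using hxy))
      (fun z hz hzr => ?_) (hU 4 0 rfl).1 (hU 4 0 rfl).2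
    obtain ⟨x, hx, y, hy, hne, rfl⟩ := hVdiff z ⟨hz, hzr⟩
    exact hUmem x hx y hy hne
  have hfb : ∀ z ∈ V, ∀ a b : ℕ, a + b = 4 →
      |mixedPartial a b f z| ≤ |Cb| * ‖z‖ ^ (2 * ν - 4) := by
    intro z hz a b hab
    obtain ⟨x, hx, y, hy, hne, rfl⟩ := hVdiff z hz
    exact (hCb a b hab x hx y hy hne).trans
      (mul_le_mul_of_nonneg_right (le_abs_self _) (by positivity))
  set C : ℝ := 256 * D ^ 2 * |Cb| * (2 * L) ^ (4 - 2 * ν) * R ^ 4 with hC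
  refine ⟨C + 1, by positivity, ρ, hρ0, min h₁ (min (ρ₁ / 4) ((4 * R * L)⁻¹ ^ 2)), by positivity,
    fun h hh p hp p' hp' hdist => ?_⟩
  have hmin := hh.2
  simp only [lt_min_iff] at hmin
  have hh0 : 0 < h := hh.1
  have hsqrt0 : 0 < Real.sqrt h := Real.sqrt_pos.2 hh0
  have hsqrt : 4 * R * L * Real.sqrt h ≤ 1 := by
    have h1 : Real.sqrt h ≤ (4 * R * L)⁻¹ := (Real.sqrt_le_iff).2 ⟨by positivity, hmin.2.2.le⟩
    calc 4 * R * L * Real.sqrt h ≤ 4 * R * L * (4 * R * L)⁻¹ := by gcongr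
      _ = 1 := mul_inv_cancel₀ (by positivity)
  have corner : ∀ p ∈ Metric.ball p₀ ρ, ∀ k, p + h • cellVertex k ∈ Metric.ball p₀ ρ₁ := by
    intro p hp k
    rw [Metric.mem_ball, dist_eq_norm] at hp ⊢
    have h1 : ‖h • cellVertex k‖ ≤ h * 2 := by
      rw [norm_smul, Real.norm_of_nonneg hh0.le]
      exact mul_le_mul_of_nonneg_left (norm_cellVertex_le k) hh0.le
    have h2 := norm_add_le (p - p₀) (h • cellVertex k)
    rw [show p + h • cellVertex k - p₀ = p - p₀ + h • cellVertex k by abel]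
    linarith [hmin.2.1]
  have cell : ∀ p ∈ Metric.ball p₀ ρ, rescaledCell φ p h ∈ 𝒦 := fun p hp =>
    H₁ h ⟨hh0, hmin.1⟩ p fun k => (hρ₁ball (corner p hp k)).2
  have near : ∀ p ∈ Metric.ball p₀ ρ, ∀ k, ‖imageCell φ p h k - φ p‖ ≤ R * h := by
    intro p hp k
    have h1 := (norm_le_pi_norm _ k).trans (hR₀ _ (cell p hp))
    rw [imageCell_eq φ p hh0.ne', add_sub_cancel_left, norm_smul, Real.norm_of_nonneg hh0.le,
      mul_comm]
    gcongr
    linarith [le_abs_self R₀]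
  have nondeg : ∀ p ∈ Metric.ball p₀ ρ, imageCell φ p h ∈ nondegCells := by
    intro p hp
    rw [imageCell_eq φ p hh0.ne']
    exact affine_mem_nondegCells (hsub (cell p hp)) _ hh0.ne'
  have weight : ∀ p ∈ Metric.ball p₀ ρ, ∀ k, |cellWeight ℓ (imageCell φ p h) k| ≤ h⁻¹ * D := by
    intro p hp k
    rw [imageCell_eq φ p hh0.ne', cellWeight_affine ℓ (hsub (cell p hp)) _ hh0.ne', abs_mul,
      abs_of_pos (inv_pos.2 hh0)]
    exact mul_le_mul_of_nonneg_left (hD _ (cell p hp) k) (by positivity)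
  have inball : ∀ p ∈ Metric.ball p₀ ρ, ∀ k, ∀ s ∈ Icc (0 : ℝ) 1,
      φ p + s • (imageCell φ p h k - φ p) ∈ Metric.ball (φ p₀) r := by
    intro p hp k s hs
    refine (convex_ball (φ p₀) r).add_smul_sub_mem ?_ ((hρ₁ball (corner p hp k)).1) hs
    exact (hρ₁ball (Metric.ball_subset_ball (by linarith) hp)).1
  have hz : Real.sqrt h / L ≤ ‖φ p - φ p'‖ := by
    rw [div_le_iff₀ hL, mul_comm]
    exact hdist.trans (hLρ p hp p' hp')
  -- Moving both end points within their cells costs at most half of the distance √h/L.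
  have hRh : 2 * (R * h) ≤ Real.sqrt h / (2 * L) := by
    rw [le_div_iff₀ (by positivity)]
    have := mul_le_mul_of_nonneg_right hsqrt hsqrt0.le
    have hss := Real.mul_self_sqrt hh0.le
    nlinarith
  have lower : ∀ k l, ∀ s ∈ Icc (0 : ℝ) 1, ∀ t ∈ Icc (0 : ℝ) 1, Real.sqrt h / (2 * L) ≤
      ‖φ p - φ p' + s • (imageCell φ p h k - φ p) - t • (imageCell φ p' h l - φ p')‖ := by
    intro k l s hs t ht
    have b1 : ‖s • (imageCell φ p h k - φ p)‖ ≤ R * h := by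
      rw [norm_smul, Real.norm_of_nonneg hs.1]
      exact (mul_le_of_le_one_left (norm_nonneg _) hs.2).trans (near p hp k)
    have b2 : ‖t • (imageCell φ p' h l - φ p')‖ ≤ R * h := by
      rw [norm_smul, Real.norm_of_nonneg ht.1]
      exact (mul_le_of_le_one_left (norm_nonneg _) ht.2).trans (near p' hp' l)
    have b3 := norm_sub_norm_le (φ p - φ p' + s • (imageCell φ p h k - φ p))
      (t • (imageCell φ p' h l - φ p'))
    have b4 := norm_sub_norm_le (φ p - φ p') (-(s • (imageCell φ p h k - φ p)))
    rw [sub_neg_eq_add, norm_neg] at b4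
    have b5 : Real.sqrt h / L = 2 * (Real.sqrt h / (2 * L)) := by field_simp
    linarith
  have hlow0 : 0 < Real.sqrt h / (2 * L) := by positivity
  have inV : ∀ k l, ∀ s ∈ Icc (0 : ℝ) 1, ∀ t ∈ Icc (0 : ℝ) 1,
      φ p - φ p' + s • (imageCell φ p h k - φ p) - t • (imageCell φ p' h l - φ p') ∈ V := by
    intro k l s hs t ht
    refine ⟨norm_pos_iff.1 (hlow0.trans_le (lower k l s hs t ht)), ?_⟩
    have b1 := inball p hp k s hs
    have b2 := inball p' hp' l t ht
    rw [Metric.mem_ball] at b1 b2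
    have b3 := dist_triangle_right (φ p + s • (imageCell φ p h k - φ p))
      (φ p' + t • (imageCell φ p' h l - φ p')) (φ p₀)
    rw [dist_eq_norm] at b3
    rw [show φ p - φ p' + s • (imageCell φ p h k - φ p) - t • (imageCell φ p' h l - φ p')
      = φ p + s • (imageCell φ p h k - φ p) - (φ p' + t • (imageCell φ p' h l - φ p')) by abel]
    linarith
  have main := abs_cellCov_le_of_fourth_deriv (K := K) (ℓ := ℓ) hV hf4 (nondeg p hp) (nondeg p' hp')
    hKf inV (B := |Cb| * (Real.sqrt h / (2 * L)) ^ (2 * ν - 4))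
    (fun k l s hs t ht a b hab => (hfb _ (inV k l s hs t ht) a b hab).trans
      (mul_le_mul_of_nonneg_left (Real.rpow_le_rpow_of_nonpos hlow0 (lower k l s hs t ht)
        (by linarith [hν.2])) (abs_nonneg _)))
    (weight p hp) (weight p' hp') (near p hp) (near p' hp')
  have hpow : (Real.sqrt h / (2 * L)) ^ (2 * ν - 4) = h ^ ν * h⁻¹ ^ 2 * (2 * L) ^ (4 - 2 * ν) := by
    rw [Real.div_rpow hsqrt0.le (by positivity), Real.sqrt_eq_rpow, ← Real.rpow_mul hh0.le,
      show 4 - 2 * ν = -(2 * ν - 4) by ring, Real.rpow_neg (by positivity), div_eq_mul_inv,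
      show 1 / 2 * (2 * ν - 4) = ν - 2 by ring, Real.rpow_sub hh0, Real.rpow_two, div_eq_mul_inv,
      inv_pow]
  refine main.trans ?_
  rw [hpow, add_mul C]
  have e : 256 * (h⁻¹ * D) ^ 2 * (|Cb| * (h ^ ν * h⁻¹ ^ 2 * (2 * L) ^ (4 - 2 * ν))) * (R * h) ^ 4
      = C * h ^ ν := by
    rw [hC]
    field_simp
  rw [e]
  linarith [Real.rpow_nonneg hh0.le ν]

end CellCov

/-! ### Almost sure bounds for sums of squares of Gaussian variables -/

section AlmostSure

variable {S : Type*} [MeasurableSpace S] {P : Measure S} [IsProbabilityMeasure P]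

lemma ae_eventually_notMem_of_summable {E : ℕ → Set S} {g : ℕ → ℝ} (hg : Summable g)
    (hE : ∀ᶠ n in atTop, P.real (E n) ≤ g n) : ∀ᵐ s ∂P, ∀ᶠ n in atTop, s ∉ E n := by
  have h1 : Summable fun n => P.real (E n) :=
    Summable.of_norm_bounded_eventually_nat hg (hE.mono fun n hn => by
      rwa [Real.norm_of_nonneg measureReal_nonneg])
  refine ae_eventually_notMem ?_
  have h2 := h1.tsum_ofReal_ne_top
  have h3 : ∀ n, ENNReal.ofReal (P.real (E n)) = P (E n) := fun n => ofReal_measureReal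
  simpa only [h3] using h2

lemma summable_exp_neg_mul_rpow {c ε : ℝ} (hc : 0 < c) (hε : 0 < ε) :
    Summable fun n : ℕ => Real.exp (-(c * (n : ℝ) ^ ε)) := by
  have h1 := isLittleO_exp_neg_mul_rpow_atTop hc (-(2 / ε))
  have h2 : Tendsto (fun n : ℕ => (n : ℝ) ^ ε) atTop atTop :=
    (tendsto_rpow_atTop hε).comp tendsto_natCast_atTop_atTop
  have h3 := (h1.comp_tendsto h2).isBigO
  refine summable_of_isBigO_nat (g := fun n : ℕ => ((n : ℝ) ^ ε) ^ (-(2 / ε))) ?_ ?_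
  · have : ∀ n : ℕ, ((n : ℝ) ^ ε) ^ (-(2 / ε)) = (n : ℝ) ^ (-2 : ℝ) := by
      intro n
      rw [← Real.rpow_mul (Nat.cast_nonneg n)]
      congr 1
      field_simp
    simp_rw [this]
    exact Real.summable_nat_rpow.2 (by norm_num)
  · refine h3.congr_left fun n => ?_
    simp [Function.comp]

lemma ae_eventually_lt_sum_sq {ι : ℕ → Type*} [∀ n, Fintype (ι n)] {Z : ∀ n, ι n → S → ℝ}
    (hZ : ∀ n, HasGaussianLaw (fun s => (Z n · s)) P) (h0 : ∀ n i, ∫ s, Z n i s ∂P = 0)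
    {m F : ℕ → ℝ} {c ε : ℝ} (hc : 0 < c) (hε : 0 < ε)
    (hm : ∀ᶠ n in atTop, 0 ≤ m n ∧ m n ≤ ∑ i, Var[Z n i; P])
    (hF : ∀ᶠ n in atTop, 0 < F n ∧ ∑ i, ∑ j, cov[Z n i, Z n j; P] ^ 2 ≤ F n)
    (hmF : ∀ᶠ n : ℕ in atTop, c * (n : ℝ) ^ ε ≤ m n ^ 2 / (16 * F n)) :
    ∀ᵐ s ∂P, ∀ᶠ n in atTop, m n / 2 < ∑ i, Z n i s ^ 2 := by
  have := ae_eventually_notMem_of_summable (P := P)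
    (E := fun n => {s | ∑ i, Z n i s ^ 2 ≤ m n / 2}) (summable_exp_neg_mul_rpow hc hε) (by
      filter_upwards [hm, hF, hmF] with n h1 h2 h3
      refine ((hZ n).measureReal_sum_sq_le (h0 n) h1.1 h2.1 h1.2 h2.2).trans ?_
      exact Real.exp_le_exp.2 (neg_le_neg h3))
  filter_upwards [this] with s hs
  filter_upwards [hs] with n hn
  exact not_le.1 hn

/-- At the level 8v log n the Gaussian tail is 2n⁻⁴; a union over at most n² variables leaves the
summable 2n⁻². -/
lemma ae_eventually_sq_le {κ : Type*} {J : ℕ → Finset κ} {Z : ℕ → κ → S → ℝ}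
    (hZ : ∀ n i, HasGaussianLaw (Z n i) P) (h0 : ∀ n i, ∫ s, Z n i s ∂P = 0) {v : ℕ → ℝ}
    (hJ : ∀ᶠ n : ℕ in atTop, ((J n).card : ℝ) ≤ (n : ℝ) ^ 2)
    (hv : ∀ᶠ n in atTop, 0 < v n ∧ ∀ i ∈ J n, Var[Z n i; P] ≤ v n) :
    ∀ᵐ s ∂P, ∀ᶠ n : ℕ in atTop, ∀ i ∈ J n, Z n i s ^ 2 ≤ 8 * v n * Real.log n := by
  have hsum : Summable fun n : ℕ => 2 * ((n : ℝ) ^ 2)⁻¹ :=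
    (Real.summable_nat_pow_inv.2 one_lt_two).mul_left 2
  have := ae_eventually_notMem_of_summable (P := P)
    (E := fun n => ⋃ i ∈ J n, {s | Real.sqrt (8 * v n * Real.log n) ≤ |Z n i s|}) hsum (by
      filter_upwards [hJ, hv, eventually_ge_atTop 1] with n h1 h2 h3
      have hn0 : (0 : ℝ) < n := by exact_mod_cast h3
      have hlog : 0 ≤ Real.log n := Real.log_nonneg (by exact_mod_cast h3)
      have hv0 := h2.1
      refine (measureReal_biUnion_finset_le _ _).trans ?_
      have hterm : ∀ i ∈ J n, P.real {s | Real.sqrt (8 * v n * Real.log n) ≤ |Z n i s|}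
          ≤ 2 * ((n : ℝ) ^ 4)⁻¹ := by
        intro i hi
        refine ((hZ n i).measureReal_abs_ge_le (h0 n i) (h2.2 i hi) (Real.sqrt_nonneg _)).trans ?_
        rw [Real.sq_sqrt (by positivity)]
        have : -(8 * v n * Real.log n) / (2 * v n) = Real.log (((n : ℝ) ^ 4)⁻¹) := by
          rw [Real.log_inv, Real.log_pow]
          field_simp
          push_cast
          ring
        rw [this, Real.exp_log (by positivity)]
      refine (Finset.sum_le_sum hterm).trans ?_
      rw [Finset.sum_const, nsmul_eq_mul]
      calc ((J n).card : ℝ) * (2 * ((n : ℝ) ^ 4)⁻¹) ≤ (n : ℝ) ^ 2 * (2 * ((n : ℝ) ^ 4)⁻¹) := by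
            gcongr
        _ = _ := by field_simp)
  filter_upwards [this] with s hs
  filter_upwards [hs, hv, eventually_ge_atTop 1] with n hn h2 h3 i hi
  have hlog : 0 ≤ Real.log n := Real.log_nonneg (by exact_mod_cast h3)
  have hlt : |Z n i s| < Real.sqrt (8 * v n * Real.log n) := by
    by_contra hcon
    exact hn (mem_biUnion hi (not_lt.1 hcon))
  have h4 := pow_le_pow_left₀ (abs_nonneg _) hlt.le 2
  rwa [sq_abs, Real.sq_sqrt (by have := h2.1; positivity)] at h4

/-- The extra factor log n is invisible because log log n / log n tends to 0. -/
lemma tendsto_log_div_log_of_bounds {V : ℕ → ℝ} {c C γ : ℝ} (hc : 0 < c) (hC : 0 < C)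
    (h1 : ∀ᶠ n : ℕ in atTop, c * (n : ℝ) ^ γ ≤ V n)
    (h2 : ∀ᶠ n : ℕ in atTop, V n ≤ C * (n : ℝ) ^ γ * Real.log n) :
    Tendsto (fun n : ℕ => Real.log (V n) / Real.log n) atTop (𝓝 γ) := by
  have hlog : Tendsto (fun n : ℕ => Real.log n) atTop atTop :=
    Real.tendsto_log_atTop.comp tendsto_natCast_atTop_atTop
  have hinv : Tendsto (fun n : ℕ => (Real.log n)⁻¹) atTop (𝓝 0) := hlog.inv_tendsto_atTop
  have hloglog : Tendsto (fun n : ℕ => Real.log (Real.log n) / Real.log n) atTop (𝓝 0) :=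
    Real.isLittleO_log_id_atTop.tendsto_div_nhds_zero.comp hlog
  have hlow : Tendsto (fun n : ℕ => Real.log c * (Real.log n)⁻¹ + γ) atTop (𝓝 γ) := by
    simpa using (hinv.const_mul (Real.log c)).add_const γ
  have hupp : Tendsto (fun n : ℕ => Real.log C * (Real.log n)⁻¹ + γ
      + Real.log (Real.log n) / Real.log n) atTop (𝓝 γ) := by
    simpa using ((hinv.const_mul (Real.log C)).add_const γ).add hloglog
  refine tendsto_of_tendsto_of_tendsto_of_le_of_le' hlow hupp ?_ ?_
  · filter_upwards [h1, hlog.eventually_gt_atTop 0, eventually_ge_atTop 1] with n h1 hl hn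
    have hn0 : (0 : ℝ) < n := by exact_mod_cast hn
    have hp : 0 < (n : ℝ) ^ γ := Real.rpow_pos_of_pos hn0 _
    have := Real.log_le_log (by positivity) h1
    rw [Real.log_mul hc.ne' hp.ne', Real.log_rpow hn0] at this
    rw [le_div_iff₀ hl, add_mul, mul_assoc, inv_mul_cancel₀ hl.ne', mul_one]
    exact this
  · filter_upwards [h1, h2, hlog.eventually_gt_atTop 0, eventually_ge_atTop 1] with n h1 h2 hl hn
    have hn0 : (0 : ℝ) < n := by exact_mod_cast hn
    have hp : 0 < (n : ℝ) ^ γ := Real.rpow_pos_of_pos hn0 _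
    have := Real.log_le_log ((by positivity : 0 < c * (n : ℝ) ^ γ).trans_le h1) h2
    rw [Real.log_mul (by positivity) hl.ne', Real.log_mul hC.ne' hp.ne', Real.log_rpow hn0] at this
    rw [div_le_iff₀ hl, add_mul, add_mul, mul_assoc, inv_mul_cancel₀ hl.ne', mul_one,
      div_mul_cancel₀ _ hl.ne']
    exact this

end AlmostSure

lemma abs_covariance_le_of_variance_le {S : Type*} [MeasurableSpace S] {P : Measure S}
    [IsProbabilityMeasure P] {Y Z : S → ℝ} (hY : MemLp Y 2 P) (hZ : MemLp Z 2 P) {A : ℝ}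
    (hYA : Var[Y; P] ≤ A) (hZA : Var[Z; P] ≤ A) : |cov[Y, Z; P]| ≤ A := by
  have h1 := variance_add hY hZ
  have h2 := variance_sub hY hZ
  have h3 := variance_nonneg (Y + Z) P
  have h4 := variance_nonneg (Y - Z) P
  rw [abs_le]
  constructor <;> linarith

/-! ### The second-order differences of the field -/

section Field

variable {S : Type*} [MeasurableSpace S] {P : Measure S} {X : Plane → S → ℝ} {m : ℝ}
  {K : Plane → Plane → ℝ}

lemma ProbabilityTheory.IsGaussianProcess.hasGaussianLaw_pi {T ι : Type*} [Fintype ι]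
    {Y : T → S → ℝ} (hY : IsGaussianProcess Y P) (f : ι → T) :
    HasGaussianLaw (fun s i => Y (f i) s) P := by
  classical
  let L : (Finset.univ.image f → ℝ) →L[ℝ] (ι → ℝ) := ContinuousLinearMap.pi fun i =>
    ContinuousLinearMap.proj (R := ℝ)
      (⟨f i, Finset.mem_image_of_mem f (Finset.mem_univ i)⟩ : Finset.univ.image f)
  exact (hY.hasGaussianLaw (Finset.univ.image f)).map_fun L

/-- The second-order difference of the field on a cell. -/
noncomputable def cellDiff (X : Plane → S → ℝ) (ℓ : Fin 2) (q : Fin 4 → Plane) (s : S) : ℝ :=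
  ∑ k, cellWeight ℓ q k * X (q k) s

lemma IsStationaryIsotropicGaussianField.isGaussianProcess_cellDiff
    (hX : IsStationaryIsotropicGaussianField X P m K) (ℓ : Fin 2) :
    IsGaussianProcess (cellDiff X ℓ) P := by
  classical
  refine hX.gaussian.of_isGaussianProcess fun q => ⟨Finset.univ.image q,
    ∑ k, cellWeight ℓ q k • ContinuousLinearMap.proj (R := ℝ)
      (⟨q k, Finset.mem_image_of_mem q (Finset.mem_univ k)⟩ : Finset.univ.image q), fun s => ?_⟩
  simp [cellDiff]

lemma IsStationaryIsotropicGaussianField.integral_cellDiff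
    (hX : IsStationaryIsotropicGaussianField X P m K) (ℓ : Fin 2) (q : Fin 4 → Plane) :
    ∫ s, cellDiff X ℓ q s ∂P = 0 := by
  simp only [cellDiff]
  rw [integral_finsetSum _ fun k _ =>
    ((hX.gaussian.hasGaussianLaw_eval (q k)).integrable).const_mul _]
  simp_rw [integral_const_mul, hX.mean, ← Finset.sum_mul, sum_cellWeight, zero_mul]

lemma IsStationaryIsotropicGaussianField.covariance_cellDiff [IsProbabilityMeasure P]
    (hX : IsStationaryIsotropicGaussianField X P m K) (ℓ : Fin 2) (q q' : Fin 4 → Plane) :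
    cov[cellDiff X ℓ q, cellDiff X ℓ q'; P] = cellCov K ℓ q q' := by
  have hL2 : ∀ x, MemLp (X x) 2 P := fun x => (hX.gaussian.hasGaussianLaw_eval x).memLp_two
  have := covariance_fun_sum_fun_sum (μ := P) (X := fun k s => cellWeight ℓ q k * X (q k) s)
    (Y := fun k s => cellWeight ℓ q' k * X (q' k) s)
    (fun k => (hL2 _).const_mul _) (fun k => (hL2 _).const_mul _)
  refine this.trans (Finset.sum_congr rfl fun k _ => Finset.sum_congr rfl fun l _ => ?_)
  rw [covariance_const_mul_left, covariance_const_mul_right, hX.cov, mul_assoc]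

end Field

/-! ### The quadratic variation on the deformed lattice -/

/-- The point `(i₁/n, i₂/n)` of the square lattice. -/
noncomputable def gridPoint (n : ℕ) (i : ℕ × ℕ) : Plane := !₂[(i.1 : ℝ) / n, (i.2 : ℝ) / n]

/-- The index set of the cells in the quadratic variation. -/
def cellIndices (n θ : ℕ) : Finset (ℕ × ℕ) := Finset.Icc 1 (n - θ) ×ˢ Finset.Icc 1 (n - θ)

lemma quadVar_eq {S : Type*} (φ : Plane → Plane) (X : Plane → S → ℝ) (n θ : ℕ) (ℓ : Fin 2) (s : S) :
    quadVar φ (fun x => X x s) n θ ℓ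
      = ∑ i ∈ cellIndices n θ, cellDiff X ℓ (imageCell φ (gridPoint n i) ((θ : ℝ) / n)) s ^ 2 := by
  rw [quadVar, cellIndices, Finset.sum_product]
  simp_rw [gradH_sub_gradG, cellSites_eq_imageCell]
  rfl

lemma card_cellIndices_le (n θ : ℕ) : ((cellIndices n θ).card : ℝ) ≤ (n : ℝ) ^ 2 := by
  rw [cellIndices, Finset.card_product, Nat.card_Icc, sq]
  have h : ((n - θ + 1 - 1 : ℕ) : ℝ) ≤ n := by
    have h0 : n - θ + 1 - 1 ≤ n := by omega
    exact_mod_cast h0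
  rw [Nat.cast_mul]
  exact mul_le_mul h h (Nat.cast_nonneg _) (Nat.cast_nonneg _)

lemma corner_mem_unitSquare {n θ : ℕ} {i : ℕ × ℕ} (hi : i ∈ cellIndices n θ) (k : Fin 4) :
    gridPoint n i + ((θ : ℝ) / n) • cellVertex k ∈ unitSquare := by
  simp only [cellIndices, Finset.mem_product, Finset.mem_Icc] at hi
  have hn : (0 : ℝ) < n := by exact_mod_cast (by omega)
  have key : ∀ a : ℕ, 1 ≤ a → a ≤ n - θ → (0 : ℝ) ≤ a / n ∧ (a : ℝ) / n ≤ 1 ∧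
      (0 : ℝ) ≤ a / n + θ / n ∧ (a : ℝ) / n + θ / n ≤ 1 := by
    intro a h1 h2
    refine ⟨by positivity, ?_, by positivity, ?_⟩
    · rw [div_le_one hn]
      exact_mod_cast (by omega)
    · rw [← add_div, div_le_one hn]
      exact_mod_cast (by omega)
  have k1 := key i.1 hi.1.1 hi.1.2
  have k2 := key i.2 hi.2.1 hi.2.2
  intro j
  fin_cases j <;> fin_cases k <;> simp [gridPoint, cellVertex] <;> tauto

lemma eventually_div_mem_Ioo {θ : ℕ} (hθ : 1 ≤ θ) {h₀ : ℝ} (hh₀ : 0 < h₀) :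
    ∀ᶠ n : ℕ in atTop, (θ : ℝ) / n ∈ Ioo 0 h₀ := by
  have h1 : Tendsto (fun n : ℕ => (θ : ℝ) / n) atTop (𝓝 0) := tendsto_const_div_atTop_nhds_zero_nat _
  filter_upwards [h1.eventually_lt_const hh₀, eventually_ge_atTop 1] with n hn hn1
  have hθ0 : (0 : ℝ) < θ := by exact_mod_cast hθ
  have hn0 : (0 : ℝ) < n := by exact_mod_cast hn1
  exact ⟨by positivity, hn⟩

/-! ### Blocks of lattice cells: counting and separation -/

lemma Plane.norm_le_abs_add (v : Plane) : ‖v‖ ≤ |v 0| + |v 1| := by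
  conv_lhs => rw [Plane.eq_sum_single v]
  refine (norm_add_le _ _).trans (le_of_eq ?_)
  simp [norm_smul]

lemma card_Ico_near_le (a L X s : ℕ) :
    ((Finset.Ico a (a + L)).filter fun t => t < s + X ∧ s < t + X).card ≤ 2 * X := by
  refine (Finset.card_le_card (t := Finset.Ico (s - X) (s + X)) fun t ht => ?_).trans ?_
  · simp only [Finset.mem_filter, Finset.mem_Ico] at ht ⊢
    omega
  · rw [Nat.card_Ico]
    omega

/-- Bound for a double sum over a square block, with a larger bound for neighbours. -/
lemma sum_block_sq_le (a b L X : ℕ) (g : ℕ × ℕ → ℕ × ℕ → ℝ) {A B : ℝ}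
    (hA : ∀ i ∈ Finset.Ico a (a + L) ×ˢ Finset.Ico b (b + L),
      ∀ j ∈ Finset.Ico a (a + L) ×ˢ Finset.Ico b (b + L), |g i j| ≤ A)
    (hB : ∀ i ∈ Finset.Ico a (a + L) ×ˢ Finset.Ico b (b + L),
      ∀ j ∈ Finset.Ico a (a + L) ×ˢ Finset.Ico b (b + L),
      ¬((j.1 < i.1 + X ∧ i.1 < j.1 + X) ∧ (j.2 < i.2 + X ∧ i.2 < j.2 + X)) → |g i j| ≤ B) :
    ∑ i ∈ Finset.Ico a (a + L) ×ˢ Finset.Ico b (b + L),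
      ∑ j ∈ Finset.Ico a (a + L) ×ˢ Finset.Ico b (b + L), g i j ^ 2
      ≤ (L : ℝ) ^ 2 * (4 * (X : ℝ) ^ 2 * A ^ 2 + (L : ℝ) ^ 2 * B ^ 2) := by
  classical
  set J := Finset.Ico a (a + L) ×ˢ Finset.Ico b (b + L) with hJ
  have hcard : (J.card : ℝ) = (L : ℝ) ^ 2 := by
    rw [hJ, Finset.card_product, Nat.card_Ico, Nat.card_Ico]
    push_cast [Nat.add_sub_cancel_left]
    ring
  have inner : ∀ i ∈ J, ∑ j ∈ J, g i j ^ 2 ≤ 4 * (X : ℝ) ^ 2 * A ^ 2 + (L : ℝ) ^ 2 * B ^ 2 := by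
    intro i hi
    rw [← Finset.sum_filter_add_sum_filter_not J
      (fun j => (j.1 < i.1 + X ∧ i.1 < j.1 + X) ∧ (j.2 < i.2 + X ∧ i.2 < j.2 + X))]
    refine add_le_add ?_ ?_
    · have hnear : ((J.filter fun j =>
          (j.1 < i.1 + X ∧ i.1 < j.1 + X) ∧ (j.2 < i.2 + X ∧ i.2 < j.2 + X)).card : ℝ)
          ≤ 4 * (X : ℝ) ^ 2 := by
        rw [hJ, Finset.filter_product (fun t => t < i.1 + X ∧ i.1 < t + X)
          (fun t => t < i.2 + X ∧ i.2 < t + X), Finset.card_product]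
        have h1 := card_Ico_near_le a L X i.1
        have h2 := card_Ico_near_le b L X i.2
        have h3 := Nat.mul_le_mul h1 h2
        calc _ ≤ ((2 * X * (2 * X) : ℕ) : ℝ) := by exact_mod_cast h3
          _ = _ := by push_cast; ring
      refine (Finset.sum_le_card_nsmul _ _ (A ^ 2) fun j hj => ?_).trans ?_
      · exact sq_le_sq' (by linarith [abs_le.1 (hA i hi j (Finset.mem_filter.1 hj).1)])
          (abs_le.1 (hA i hi j (Finset.mem_filter.1 hj).1)).2
      · rw [nsmul_eq_mul]
        gcongr
    · refine (Finset.sum_le_card_nsmul _ _ (B ^ 2) fun j hj => ?_).trans ?_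
      · have hj' := Finset.mem_filter.1 hj
        have := abs_le.1 (hB i hi j hj'.1 hj'.2)
        exact sq_le_sq' (by linarith) this.2
      · rw [nsmul_eq_mul, ← hcard]
        gcongr
        exact Finset.filter_subset _ _
  refine (Finset.sum_le_card_nsmul _ _ _ inner).trans (le_of_eq ?_)
  rw [nsmul_eq_mul, hcard]

/-- A neighbourhood of an interior point contains a square block with a positive fraction of the
lattice. -/
lemma exists_block {p₀ : Plane} (hp₀ : ∀ j, p₀ j ∈ Ioo (0 : ℝ) 1) {ρ : ℝ} (hρ : 0 < ρ) (θ : ℕ) :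
    ∃ κ : ℝ, 0 < κ ∧ ∃ a b L : ℕ → ℕ, ∀ᶠ n : ℕ in atTop, κ * n ≤ L n ∧ (L n : ℝ) ≤ n ∧
      ∀ i ∈ Finset.Ico (a n) (a n + L n) ×ˢ Finset.Ico (b n) (b n + L n),
        i ∈ cellIndices n θ ∧ gridPoint n i ∈ Metric.ball p₀ ρ := by
  set r : ℝ := min (ρ / 4) (min ((1 - p₀ 0) / 4) ((1 - p₀ 1) / 4)) with hr_def
  have hr0 : 0 < r := by
    have h0 := (hp₀ 0).2
    have h1 := (hp₀ 1).2
    refine lt_min (by positivity) (lt_min ?_ ?_) <;> linarith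
  have hrρ : r ≤ ρ / 4 := min_le_left _ _
  have hrj : ∀ j, r ≤ (1 - p₀ j) / 4 := by
    intro j
    fin_cases j
    · exact (min_le_right _ _).trans (min_le_left _ _)
    · exact (min_le_right _ _).trans (min_le_right _ _)
  -- The block starts just above n p₀, with indices at least 1, and has side about nr; r is small
  -- enough to leave room for the shift by θ. Halving r absorbs the floor.
  refine ⟨r / 2, by positivity, fun n => ⌊n * p₀ 0⌋₊ + 1, fun n => ⌊n * p₀ 1⌋₊ + 1,
    fun n => ⌊n * r⌋₊, ?_⟩
  have hlarge : ∀ᶠ n : ℕ in atTop, (2 + θ : ℝ) < n * r :=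
    (tendsto_natCast_atTop_atTop.atTop_mul_const hr0).eventually_gt_atTop _
  filter_upwards [hlarge] with n hn
  have hθ0 : (0 : ℝ) ≤ θ := Nat.cast_nonneg θ
  have hn0 : (0 : ℝ) < n := by
    by_contra hcon
    nlinarith
  have hLle : (⌊n * r⌋₊ : ℝ) ≤ n * r := Nat.floor_le (by positivity)
  have hLgt : n * r < ⌊n * r⌋₊ + 1 := Nat.lt_floor_add_one _
  have hr1 : r ≤ 1 := by
    have := hrj 0
    have := (hp₀ 0).1
    linarith
  have coord : ∀ (j : Fin 2) (t : ℕ), t ∈ Finset.Ico (⌊n * p₀ j⌋₊ + 1) (⌊n * p₀ j⌋₊ + 1 + ⌊n * r⌋₊) →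
      t ∈ Finset.Icc 1 (n - θ) ∧ |(t : ℝ) / n - p₀ j| < 2 * r := by
    intro j t ht
    rw [Finset.mem_Ico] at ht
    have hpj := (hp₀ j).1
    have h1 : (⌊n * p₀ j⌋₊ : ℝ) ≤ n * p₀ j := Nat.floor_le (by positivity)
    have h2 : n * p₀ j < ⌊n * p₀ j⌋₊ + 1 := Nat.lt_floor_add_one _
    have h3 : (⌊n * p₀ j⌋₊ : ℝ) + 1 ≤ t := by exact_mod_cast ht.1
    have h4 : (t : ℝ) < ⌊n * p₀ j⌋₊ + 1 + ⌊n * r⌋₊ := by exact_mod_cast ht.2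
    have h5 := hrj j
    have h6 : n * r ≤ n * ((1 - p₀ j) / 4) := mul_le_mul_of_nonneg_left h5 hn0.le
    refine ⟨Finset.mem_Icc.2 ⟨by omega, ?_⟩, ?_⟩
    · have h7 : (t : ℝ) + θ < n := by linarith
      have h8 : t + θ < n := by exact_mod_cast h7
      omega
    · rw [show (t : ℝ) / n - p₀ j = (t - n * p₀ j) / n by field_simp, abs_div, abs_of_pos hn0,
        div_lt_iff₀ hn0, abs_lt]
      constructor <;> linarith
  refine ⟨by linarith, ?_, fun i hi => ?_⟩
  · nlinarith
  · rw [Finset.mem_product] at hi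
    obtain ⟨c1, d1⟩ := coord 0 i.1 hi.1
    obtain ⟨c2, d2⟩ := coord 1 i.2 hi.2
    refine ⟨Finset.mem_product.2 ⟨c1, c2⟩, ?_⟩
    rw [Metric.mem_ball, dist_eq_norm]
    refine (Plane.norm_le_abs_add _).trans_lt ?_
    have e0 : (gridPoint n i - p₀) 0 = (i.1 : ℝ) / n - p₀ 0 := by simp [gridPoint]
    have e1 : (gridPoint n i - p₀) 1 = (i.2 : ℝ) / n - p₀ 1 := by simp [gridPoint]
    rw [e0, e1]
    linarith

/-- Lattice points whose indices differ by at least `√(θ n)` are at distance at least `√(θ/n)`. -/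
lemma sqrt_le_norm_gridPoint_sub {n θ X : ℕ} (hn : 1 ≤ n) (hX : Real.sqrt (θ * n) ≤ X)
    {i j : ℕ × ℕ}
    (hij : ¬((j.1 < i.1 + X ∧ i.1 < j.1 + X) ∧ (j.2 < i.2 + X ∧ i.2 < j.2 + X))) :
    Real.sqrt ((θ : ℝ) / n) ≤ ‖gridPoint n i - gridPoint n j‖ := by
  have hn0 : (0 : ℝ) < n := by exact_mod_cast hn
  have hs : Real.sqrt ((θ : ℝ) / n) = Real.sqrt (θ * n) / n := by
    rw [show (θ : ℝ) / n = θ * n / n ^ 2 by field_simp, Real.sqrt_div' _ (by positivity),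
      Real.sqrt_sq hn0.le]
  have far : ∀ s t : ℕ, ¬(t < s + X ∧ s < t + X) → Real.sqrt ((θ : ℝ) / n) ≤ |(s : ℝ) / n - t / n| := by
    intro s t hst
    rw [hs, ← sub_div, abs_div, abs_of_pos hn0]
    gcongr
    refine hX.trans ?_
    rw [le_abs]
    have : s + X ≤ t ∨ t + X ≤ s := by omega
    rcases this with h | h
    · right
      have : (s : ℝ) + X ≤ t := by exact_mod_cast h
      linarith
    · left
      have : (t : ℝ) + X ≤ s := by exact_mod_cast h
      linarith
  rw [not_and_or] at hij
  rcases hij with h | h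
  · have := Plane.abs_apply_le (gridPoint n i - gridPoint n j) 0
    exact (far _ _ h).trans (by simpa [gridPoint] using this)
  · have := Plane.abs_apply_le (gridPoint n i - gridPoint n j) 1
    exact (far _ _ h).trans (by simpa [gridPoint] using this)

/-! ### Almost sure bounds for the quadratic variation -/

section QuadraticVariation

variable {S : Type*} [MeasurableSpace S] {P : Measure S} [IsProbabilityMeasure P]
  {X : Plane → S → ℝ} {m : ℝ} {K : Plane → Plane → ℝ} {φ : Plane → Plane} {Ω : Set Plane} {ν : ℝ}
  {θ : ℕ} {ℓ : Fin 2}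

lemma IsStationaryIsotropicGaussianField.variance_cellDiff
    (hX : IsStationaryIsotropicGaussianField X P m K) (q : Fin 4 → Plane) :
    Var[cellDiff X ℓ q; P] = |cellCov K ℓ q q| := by
  have h : Var[cellDiff X ℓ q; P] = cellCov K ℓ q q := by
    rw [← hX.covariance_cellDiff,
      covariance_self ((hX.isGaussianProcess_cellDiff ℓ).aemeasurable q)]
  rw [← h, abs_of_nonneg (variance_nonneg _ _)]

lemma ae_eventually_quadVar_le (hν : ν ∈ Ioo (0 : ℝ) 2) (hθ : 1 ≤ θ)
    (hX : IsStationaryIsotropicGaussianField X P m K) (hK : HasIrregularExpansion K ν)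
    (hΩ : IsOpen Ω) (hsq : unitSquare ⊆ Ω) (hφ : IsC2Diffeo φ Ω) :
    ∃ C > 0, ∀ᵐ s ∂P, ∀ᶠ n : ℕ in atTop,
      quadVar φ (fun x => X x s) n θ ℓ ≤ C * (n : ℝ) ^ (4 - 2 * ν) * Real.log n := by
  obtain ⟨C, hC, h₀, hh₀, H⟩ := hφ.abs_cellCov_self_le (ℓ := ℓ) hΩ hsq hν hK
  have hθ0 : (0 : ℝ) < θ := by exact_mod_cast hθ
  refine ⟨8 * C * (θ : ℝ) ^ (2 * ν - 2), by positivity, ?_⟩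
  have main := ae_eventually_sq_le (P := P) (J := fun n => cellIndices n θ)
    (Z := fun n i => cellDiff X ℓ (imageCell φ (gridPoint n i) ((θ : ℝ) / n)))
    (fun n i => (hX.isGaussianProcess_cellDiff ℓ).hasGaussianLaw_eval _)
    (fun n i => hX.integral_cellDiff ℓ _) (v := fun n => C * ((θ : ℝ) / n) ^ (2 * ν - 2))
    (Eventually.of_forall fun n => card_cellIndices_le n θ) (by
      filter_upwards [eventually_div_mem_Ioo hθ hh₀] with n hn
      refine ⟨mul_pos hC (Real.rpow_pos_of_pos hn.1 _), fun i hi => ?_⟩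
      rw [hX.variance_cellDiff]
      exact H _ hn _ (corner_mem_unitSquare hi))
  filter_upwards [main] with s hs
  filter_upwards [hs, eventually_ge_atTop 1] with n hn hn1
  have hn0 : (0 : ℝ) < n := by exact_mod_cast hn1
  have hlog : 0 ≤ Real.log n := Real.log_nonneg (by exact_mod_cast hn1)
  rw [quadVar_eq]
  refine (Finset.sum_le_card_nsmul _ _ _ hn).trans ?_
  rw [nsmul_eq_mul]
  refine (mul_le_mul_of_nonneg_right (card_cellIndices_le n θ) (by positivity)).trans
    (le_of_eq ?_)
  rw [Real.div_rpow hθ0.le hn0.le, show 4 - 2 * ν = 2 - (2 * ν - 2) by ring,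
    Real.rpow_sub hn0 2, Real.rpow_two]
  field_simp

lemma ae_eventually_le_quadVar (hν : ν ∈ Ioo (0 : ℝ) 2) (hθ : θ = 1 ∨ θ = 2)
    (hX : IsStationaryIsotropicGaussianField X P m K) (hK : HasIrregularExpansion K ν)
    (hΩ : IsOpen Ω) (hsq : unitSquare ⊆ Ω) (hφ : IsC2Diffeo φ Ω)
    (hJ : ∃ p ∈ unitSquare, calJ φ ν ℓ p ≠ 0)
    (hK_cont : ∃ U : Set Plane, IsOpen U ∧
      (∀ x ∈ φ '' unitSquare, ∀ y ∈ φ '' unitSquare, x ≠ y → x - y ∈ U) ∧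
      ∀ a₁ a₂ : ℕ, a₁ + a₂ = 4 →
        MixedPartialExistsOn a₁ a₂ (stationaryCov K) U ∧
        ContinuousOn (mixedPartial a₁ a₂ (stationaryCov K)) U)
    (hK_bound : ∃ C : ℝ, ∀ a₁ a₂ : ℕ, a₁ + a₂ = 4 →
      ∀ x ∈ φ '' unitSquare, ∀ y ∈ φ '' unitSquare, x ≠ y →
        |mixedPartial a₁ a₂ (stationaryCov K) (x - y)| ≤ C * ‖x - y‖ ^ (2 * ν - 4)) :
    ∃ c > 0, ∀ᵐ s ∂P, ∀ᶠ n : ℕ in atTop,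
      c * (n : ℝ) ^ (4 - 2 * ν) ≤ quadVar φ (fun x => X x s) n θ ℓ := by
  have hθ1 : 1 ≤ θ := by omega
  have hθ0 : (0 : ℝ) < θ := by exact_mod_cast hθ1
  have hθ2 : (θ : ℝ) ≤ 2 := by exact_mod_cast (by omega : θ ≤ 2)
  obtain ⟨p₁, hp₁, hJ₁⟩ := hJ
  obtain ⟨p₀, hp₀, hJ₀⟩ := exists_interior_calJ_ne_zero hφ hΩ hsq hν hp₁ hJ₁
  have hp₀Ω : p₀ ∈ Ω := hsq fun j => Ioo_subset_Icc_self (hp₀ j)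
  obtain ⟨C₁, hC₁, h₁, hh₁, H₁⟩ := hφ.abs_cellCov_self_le (ℓ := ℓ) hΩ hsq hν hK
  obtain ⟨c₂, hc₂, ρ₂, hρ₂, h₂, hh₂, H₂⟩ := hφ.le_abs_cellCov_self hΩ hsq hν hK hp₀Ω hJ₀
  obtain ⟨C₃, hC₃, ρ₃, hρ₃, h₃, hh₃, H₃⟩ :=
    hφ.abs_cellCov_far_le (ℓ := ℓ) hΩ hsq hν hX.isotropic hK_cont hK_bound hp₀
  obtain ⟨κ, hκ, a, b, L, hblock⟩ := exists_block hp₀ (lt_min hρ₂ hρ₃) θ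
  set J : ℕ → Finset (ℕ × ℕ) :=
    fun n => Finset.Ico (a n) (a n + L n) ×ˢ Finset.Ico (b n) (b n + L n) with hJ_def
  set q : ℕ → ℕ × ℕ → Fin 4 → Plane :=
    fun n i => imageCell φ (gridPoint n i) ((θ : ℝ) / n) with hq_def
  have hcard : ∀ n, ((J n).card : ℝ) = (L n : ℝ) ^ 2 := by
    intro n
    rw [hJ_def, Finset.card_product, Nat.card_Ico, Nat.card_Ico]
    push_cast [Nat.add_sub_cancel_left]
    ring
  have hgp := hX.isGaussianProcess_cellDiff ℓ
  -- Near pairs give n^(7-4ν) and far pairs n^(4-2ν), against the squared mean n^(8-4ν); ε is the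
  -- smaller of the two gains.
  set ε : ℝ := min 1 (4 - 2 * ν) with hε_def
  have hε : 0 < ε := lt_min one_pos (by linarith [hν.2])
  have hε1 : ε ≤ 1 := min_le_left _ _
  have hε2 : ε ≤ 4 - 2 * ν := min_le_right _ _
  set c : ℝ := κ ^ 2 * (c₂ * (θ : ℝ) ^ (2 * ν - 2)) with hc_def
  have hc : 0 < c := by positivity
  set A : ℝ := C₁ * (θ : ℝ) ^ (2 * ν - 2) with hA_def
  set B : ℝ := C₃ * (θ : ℝ) ^ ν with hB_def
  -- Here 36 = 4 · 9: the near window has at most 4Y² cells, and Y² ≤ 9n.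
  set D : ℝ := 36 * A ^ 2 + B ^ 2 with hD_def
  have hD : 0 < D := by positivity
  have hscale : ∀ n : ℕ, 1 ≤ n → ((θ : ℝ) / n) ^ (2 * ν - 2)
      = (θ : ℝ) ^ (2 * ν - 2) * (n : ℝ) ^ (2 - 2 * ν) := by
    intro n hn
    rw [Real.div_rpow hθ0.le (Nat.cast_nonneg n), show 2 - 2 * ν = -(2 * ν - 2) by ring,
      Real.rpow_neg (Nat.cast_nonneg n), div_eq_mul_inv]
  have main := ae_eventually_lt_sum_sq (P := P) (ι := fun n => J n)
    (Z := fun n i => cellDiff X ℓ (q n i))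
    (fun n => hgp.hasGaussianLaw_pi fun i : J n => q n i)
    (fun n i => hX.integral_cellDiff ℓ _)
    (m := fun n => c * (n : ℝ) ^ (4 - 2 * ν)) (F := fun n => D * (n : ℝ) ^ (8 - 4 * ν - ε))
    (c := c ^ 2 / (16 * D)) (ε := ε) (by positivity) hε
    (by
      filter_upwards [hblock, eventually_div_mem_Ioo hθ1 hh₂, eventually_ge_atTop 1]
        with n ⟨hL1, _, hmem⟩ hn hn1
      have hn0 : (0 : ℝ) < n := by exact_mod_cast hn1
      refine ⟨by positivity, ?_⟩
      rw [Finset.sum_coe_sort (J n) fun i => Var[cellDiff X ℓ (q n i); P]]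
      have hterm : ∀ i ∈ J n, c₂ * ((θ : ℝ) / n) ^ (2 * ν - 2) ≤ Var[cellDiff X ℓ (q n i); P] := by
        intro i hi
        rw [hX.variance_cellDiff]
        exact H₂ _ hn _ (Metric.ball_subset_ball (min_le_left _ _) (hmem i hi).2)
          (corner_mem_unitSquare (hmem i hi).1)
      refine le_trans ?_ (Finset.card_nsmul_le_sum _ _ _ hterm)
      rw [nsmul_eq_mul, hcard, hscale n hn1, hc_def, show 4 - 2 * ν = 2 + (2 - 2 * ν) by ring,
        Real.rpow_add hn0, Real.rpow_two]
      have h1 : (κ * n) ^ 2 ≤ (L n : ℝ) ^ 2 := pow_le_pow_left₀ (by positivity) hL1 2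
      calc κ ^ 2 * (c₂ * (θ : ℝ) ^ (2 * ν - 2)) * ((n : ℝ) ^ 2 * (n : ℝ) ^ (2 - 2 * ν))
          = (κ * n) ^ 2 * (c₂ * ((θ : ℝ) ^ (2 * ν - 2) * (n : ℝ) ^ (2 - 2 * ν))) := by ring
        _ ≤ _ := mul_le_mul_of_nonneg_right h1 (by positivity))
    (by
      filter_upwards [hblock, eventually_div_mem_Ioo hθ1 hh₁, eventually_div_mem_Ioo hθ1 hh₃,
        eventually_ge_atTop 1] with n ⟨_, hL2, hmem⟩ hn₁ hn₃ hn1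
      have hn0 : (0 : ℝ) < n := by exact_mod_cast hn1
      have hn1' : (1 : ℝ) ≤ n := by exact_mod_cast hn1
      refine ⟨by positivity, ?_⟩
      -- The index separation that corresponds to distance √h in the unit square.
      set Y : ℕ := ⌈Real.sqrt (θ * n)⌉₊ with hY
      have hY1 : Real.sqrt (θ * n) ≤ Y := Nat.le_ceil _
      have hY2 : (Y : ℝ) ^ 2 ≤ 9 * n := by
        have h1 : (Y : ℝ) < Real.sqrt (θ * n) + 1 := Nat.ceil_lt_add_one (Real.sqrt_nonneg _)
        have h2 : Real.sqrt (θ * n) ≤ 2 * Real.sqrt n := by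
          rw [Real.sqrt_le_left (by positivity), mul_pow, Real.sq_sqrt hn0.le]
          nlinarith
        have h3 : 1 ≤ Real.sqrt n := Real.one_le_sqrt.2 hn1'
        have h4 : (Y : ℝ) ≤ 3 * Real.sqrt n := by linarith
        calc (Y : ℝ) ^ 2 ≤ (3 * Real.sqrt n) ^ 2 := pow_le_pow_left₀ (Nat.cast_nonneg _) h4 2
          _ = 9 * n := by rw [mul_pow, Real.sq_sqrt hn0.le]; norm_num
      have hsum : ∑ i : J n, ∑ j : J n, cov[cellDiff X ℓ (q n i), cellDiff X ℓ (q n j); P] ^ 2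
          = ∑ i ∈ J n, ∑ j ∈ J n, cellCov K ℓ (q n i) (q n j) ^ 2 := by
        simp_rw [hX.covariance_cellDiff]
        rw [← Finset.sum_coe_sort (J n)]
        exact Finset.sum_congr rfl fun i _ =>
          Finset.sum_coe_sort (J n) fun j => cellCov K ℓ (q n i) (q n j) ^ 2
      rw [hsum]
      have hvar : ∀ i ∈ J n, Var[cellDiff X ℓ (q n i); P] ≤ A * (n : ℝ) ^ (2 - 2 * ν) := by
        intro i hi
        rw [hX.variance_cellDiff, hA_def, mul_assoc, ← hscale n hn1]
        exact H₁ _ hn₁ _ (corner_mem_unitSquare (hmem i hi).1)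
      have hbound := sum_block_sq_le (a n) (b n) (L n) Y
        (fun i j => cellCov K ℓ (q n i) (q n j)) (A := A * (n : ℝ) ^ (2 - 2 * ν))
        (B := B * (n : ℝ) ^ (-ν))
        (fun i hi j hj => by
          rw [← hX.covariance_cellDiff]
          exact abs_covariance_le_of_variance_le (hgp.hasGaussianLaw_eval _).memLp_two
            (hgp.hasGaussianLaw_eval _).memLp_two (hvar i hi) (hvar j hj))
        (fun i hi j hj hij => by
          have h1 := H₃ _ hn₃ _ (Metric.ball_subset_ball (min_le_right _ _) (hmem i hi).2) _
            (Metric.ball_subset_ball (min_le_right _ _) (hmem j hj).2)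
            (sqrt_le_norm_gridPoint_sub hn1 hY1 hij)
          rw [Real.div_rpow hθ0.le hn0.le, div_eq_mul_inv ((θ : ℝ) ^ ν), ← Real.rpow_neg hn0.le,
            ← mul_assoc] at h1
          exact h1)
      refine hbound.trans ?_
      have hL4 : (L n : ℝ) ^ 2 ≤ (n : ℝ) ^ 2 := pow_le_pow_left₀ (Nat.cast_nonneg _) hL2 2
      have e1 : ((n : ℝ) ^ (2 - 2 * ν)) ^ 2 = (n : ℝ) ^ (4 - 4 * ν) := by
        rw [← Real.rpow_natCast, ← Real.rpow_mul hn0.le]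
        congr 1
        push_cast
        ring
      have e2 : ((n : ℝ) ^ (-ν)) ^ 2 = (n : ℝ) ^ (-(2 * ν)) := by
        rw [← Real.rpow_natCast, ← Real.rpow_mul hn0.le]
        congr 1
        push_cast
        ring
      have f1 : (n : ℝ) ^ 3 * (n : ℝ) ^ (4 - 4 * ν) ≤ (n : ℝ) ^ (8 - 4 * ν - ε) := by
        rw [← Real.rpow_natCast, ← Real.rpow_add hn0]
        refine Real.rpow_le_rpow_of_exponent_le hn1' ?_
        push_cast
        linarith
      have f2 : (n : ℝ) ^ 4 * (n : ℝ) ^ (-(2 * ν)) ≤ (n : ℝ) ^ (8 - 4 * ν - ε) := by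
        rw [← Real.rpow_natCast, ← Real.rpow_add hn0]
        refine Real.rpow_le_rpow_of_exponent_le hn1' ?_
        push_cast
        linarith
      calc (L n : ℝ) ^ 2 * (4 * (Y : ℝ) ^ 2 * (A * (n : ℝ) ^ (2 - 2 * ν)) ^ 2
            + (L n : ℝ) ^ 2 * (B * (n : ℝ) ^ (-ν)) ^ 2)
          ≤ (n : ℝ) ^ 2 * (4 * (9 * n) * (A * (n : ℝ) ^ (2 - 2 * ν)) ^ 2
            + (n : ℝ) ^ 2 * (B * (n : ℝ) ^ (-ν)) ^ 2) := by gcongr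
        _ = 36 * A ^ 2 * ((n : ℝ) ^ 3 * (n : ℝ) ^ (4 - 4 * ν))
            + B ^ 2 * ((n : ℝ) ^ 4 * (n : ℝ) ^ (-(2 * ν))) := by
          rw [mul_pow A, mul_pow B, e1, e2]
          ring
        _ ≤ 36 * A ^ 2 * (n : ℝ) ^ (8 - 4 * ν - ε) + B ^ 2 * (n : ℝ) ^ (8 - 4 * ν - ε) := by
          gcongr
        _ = _ := by rw [hD_def]; ring)
    (by
      filter_upwards [eventually_ge_atTop 1] with n hn1
      have hn0 : (0 : ℝ) < n := by exact_mod_cast hn1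
      have e1 : ((n : ℝ) ^ (4 - 2 * ν)) ^ 2 = (n : ℝ) ^ (8 - 4 * ν - ε) * (n : ℝ) ^ ε := by
        rw [← Real.rpow_natCast, ← Real.rpow_mul hn0.le, ← Real.rpow_add hn0]
        congr 1
        push_cast
        ring
      have hp : 0 < (n : ℝ) ^ (8 - 4 * ν - ε) := Real.rpow_pos_of_pos hn0 _
      rw [mul_pow c, e1]
      apply le_of_eq
      field_simp)
  refine ⟨c / 2, by positivity, ?_⟩
  filter_upwards [main] with s hs
  filter_upwards [hs, hblock] with n hn ⟨_, _, hmem⟩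
  rw [quadVar_eq]
  rw [Finset.sum_coe_sort (J n) fun i => cellDiff X ℓ (q n i) s ^ 2] at hn
  -- The cells outside the block contribute nonnegative squares and are dropped.
  have hsub := Finset.sum_le_sum_of_subset_of_nonneg (f := fun i => cellDiff X ℓ (q n i) s ^ 2)
    (fun i hi => (hmem i hi).1 : J n ⊆ cellIndices n θ) fun i _ _ => sq_nonneg _
  linarith

end QuadraticVariation
-- Strong consistency of the estimator
theorem corollary4p1 {S : Type*} [MeasurableSpace S] (P : Measure S) [IsProbabilityMeasure P]
    (ν : ℝ) (hν : ν ∈ Ioo (0 : ℝ) 2) (θ : ℕ) (hθ : θ = 1 ∨ θ = 2) (ℓ : Fin 2)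
    -- the random field
    (X : Plane → S → ℝ) (m : ℝ) (K : Plane → Plane → ℝ)
    (hX : IsStationaryIsotropicGaussianField X P m K)
    (hK : HasIrregularExpansion K ν)
    -- the deformation of the lattice
    (Ω : Set Plane) (hΩ : IsOpen Ω) (hΩ_square : unitSquare ⊆ Ω)
    (φ : Plane → Plane) (hφ : IsC2Diffeo φ Ω)
    (hJ : ∃ p ∈ unitSquare, calJ φ ν ℓ p ≠ 0)
    -- regularity of the covariance function away from the origin
    (hK_cont : ∃ U : Set Plane, IsOpen U ∧
      (∀ x ∈ φ '' unitSquare, ∀ y ∈ φ '' unitSquare, x ≠ y → x - y ∈ U) ∧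
      ∀ a₁ a₂ : ℕ, a₁ + a₂ = 4 →
        MixedPartialExistsOn a₁ a₂ (stationaryCov K) U ∧
        ContinuousOn (mixedPartial a₁ a₂ (stationaryCov K)) U)
    (hK_bound : ∃ C : ℝ, ∀ a₁ a₂ : ℕ, a₁ + a₂ = 4 →
      ∀ x ∈ φ '' unitSquare, ∀ y ∈ φ '' unitSquare, x ≠ y →
        |mixedPartial a₁ a₂ (stationaryCov K) (x - y)| ≤ C * ‖x - y‖ ^ (2 * ν - 4)) :
    ∀ᵐ s ∂P, Tendsto (fun n : ℕ => nuHat φ (fun x => X x s) n θ ℓ) atTop (𝓝 ν) := by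

  obtain ⟨C, hC, hupper⟩ := ae_eventually_quadVar_le (ℓ := ℓ) hν (by omega : 1 ≤ θ) hX hK hΩ
    hΩ_square hφ
  obtain ⟨c, hc, hlower⟩ := ae_eventually_le_quadVar hν hθ hX hK hΩ hΩ_square hφ hJ hK_cont hK_bound
  filter_upwards [hupper, hlower] with s h1 h2
  have h3 := ((tendsto_log_div_log_of_bounds hc hC h2 h1).const_sub 4).div_const 2
  rwa [show (4 - (4 - 2 * ν)) / 2 = ν by ring] at h3
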